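/- Fix a real constant $\alpha>0$. An instance $\langle N,\Omega,u,v,i\rangle$ of no-budget multiple-issue quadratic voting consists of a finite set $N$ of agents, a finite set $\Omega$ of outcomes, an integer utility matrix $u\in\mathbb Z^{|N|\times|\Omega|}$, a strategy profile $v\in\mathbb Z^{|N|\times|\Omega|}$ (agent $j$ casts $v^j_\omega$ votes for $\omega$) and an agent $i\in N$. Let $v_\omega=\sum_{j\in N}v^j_\omega$ and $W=\operatorname{argmax}_{\omega\in\Omega}v_\omega$; the winner is drawn uniformly at random from $W$, so $P(\omega)=1/|W|$ for $\omega\in W$ and $P(\omega)=0$ otherwise. The total utility of agent $i$ is $$U^i(v)=\sum_{\omega\in\Omega}u^i_\omega P(\omega)-\alpha\sum_{\omega\in\Omega}(v^i_\omega)^2+\frac{\alpha}{|N|-1}\sum_{j\ne i}\sum_{\omega\in\Omega}(v^j_\omega)^2,$$ where the last term (the refund) is $0$ if $|N|=1$. Agent $i$ has a beneficial deviation from $v$ if $U^i(v^{-i},\sigma)>U^i(v)$ for some $\sigma\in\mathbb Z^{|\Omega|}$, where $(v^{-i},\sigma)$ is $v$ with the ballot of $i$ replaced by $\sigma$. Let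 $$\mathrm{DEVIATE}_\alpha=\{\langle N,\Omega,u,v,i\rangle\mid\text{agent } i\text{ has a beneficial deviation from } v\},$$ as a language of words over a finite alphabet, all integers being written in binary ($\alpha$ is a constant and not part of the input). **Theorem.** If $\alpha>0$ is rational, then $\mathrm{DEVIATE}_\alpha\in\mathrm P$. More generally, $\mathrm{DEVIATE}_\alpha\in\mathrm P$ for every real $\alpha>0$ such that, given natural numbers $p,q$ in binary, one can decide in polynomial time whether $\alpha q<p$. -/

import Mathlib

namespace QV

noncomputable section

/-! ### No-budget multiple-issue quadratic voting -/

section Mechanism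

variable {N Ω : Type} [Fintype N] [Fintype Ω]

/-- A strategy profile: `v i ω` is the (integer) number of votes agent `i` casts for `ω`. -/
abbrev Profile (N Ω : Type) : Type := N → Ω → ℤ

/-- The total number of votes for the outcome `ω`. -/
def totalVotes (v : Profile N Ω) (ω : Ω) : ℤ := ∑ i, v i ω

open Classical in
/-- The possible winners: the outcomes with the highest total number of votes. -/
def winners (v : Profile N Ω) : Finset Ω :=
  Finset.univ.filter fun ω => ∀ ω', totalVotes v ω' ≤ totalVotes v ω

open Classical in
/-- The probability that `ω` is elected: the winner is uniform among the possible winners. -/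
def electionProb (v : Profile N Ω) (ω : Ω) : ℝ :=
  if ω ∈ winners v then 1 / ((winners v).card : ℝ) else 0

/-- The price `α ∑_ω (v^i_ω)²` paid for a ballot. -/
def price (α : ℝ) (b : Ω → ℤ) : ℝ := α * ∑ ω, (b ω : ℝ) ^ 2

open Classical in
/-- The total utility of agent `i`: expected outcome utility, minus the payment, plus the refund,
which is the mean of the prices paid by the other agents. -/
def utility (α : ℝ) (u : N → Ω → ℤ) (v : Profile N Ω) (i : N) : ℝ :=
  ∑ ω, (u i ω : ℝ) * electionProb v ω - price α (v i)
    + (∑ j ∈ Finset.univ.erase i, price α (v j)) / ((Fintype.card N : ℝ) - 1)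

open Classical in
/-- Agent `i` has a strategy that, the other ballots being fixed, gives strictly more utility. -/
def HasBeneficialDeviation (α : ℝ) (u : N → Ω → ℤ) (v : Profile N Ω) (i : N) : Prop :=
  ∃ σ : Ω → ℤ, utility α u v i < utility α u (Function.update v i σ) i

end Mechanism

/-! ### Polynomial time -/

/-- The class P: membership of an arbitrary word `w` is decided, by a finite Turing machine
(with several stacks), in a number of steps polynomial in the length of `w`. -/
def InP {Γ : Type} (L : Language Γ) : Prop :=
  ∃ f : List Γ → Bool, (∀ w, f w = true ↔ w ∈ L) ∧
    Nonempty (Turing.TM2ComputableInPolyTime (id : List Γ → List Γ) Computability.encodeBool f)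

/-! ### Instances and their binary encoding -/

/-- The input alphabet. -/
inductive Sym : Type
  | bit (b : Bool)
  | minus
  | comma
  | semicolon
  | bar

/-- A natural number in binary, least significant digit first, without superfluous zeros. -/
def natCode (n : ℕ) : List Sym := n.bits.map Sym.bit

/-- An integer in binary, with a leading minus sign when it is negative. -/
def intCode (z : ℤ) : List Sym :=
  if z < 0 then Sym.minus :: natCode z.natAbs else natCode z.natAbs

/-- A row of integers, each one followed by a comma. -/
def rowCode (r : List ℤ) : List Sym := r.flatMap fun z => intCode z ++ [Sym.comma]

/-- A list of rows, each one followed by a semicolon. -/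
def rowsCode (R : List (List ℤ)) : List Sym := R.flatMap fun r => rowCode r ++ [Sym.semicolon]

/-- An instance `⟨N, Ω, u, v, i⟩`, with agents `0, …, n - 1` and outcomes `0, …, m - 1`. -/
structure Instance : Type where
  n : ℕ
  m : ℕ
  u : Fin n → Fin m → ℤ
  v : Fin n → Fin m → ℤ
  i : Fin n

/-- The rows of a matrix. -/
def rows {n m : ℕ} (A : Fin n → Fin m → ℤ) : List (List ℤ) :=
  List.ofFn fun i => List.ofFn (A i)

/-- The word that represents an instance: the utility matrix, the strategy profile, the agent.
The numbers of agents and of outcomes are the numbers of rows and of entries per row. -/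
def Instance.code (I : Instance) : List Sym :=
  rowsCode (rows I.u) ++ Sym.bar :: (rowsCode (rows I.v) ++ Sym.bar :: natCode I.i)

/-- The language DEVIATE, for the payment constant `α`. -/
def DEVIATE (α : ℝ) : Language Sym :=
  {w | ∃ I : Instance, I.code = w ∧ HasBeneficialDeviation α I.u I.v I.i}

/-- The comparison problem of `α`: the pairs of natural numbers `p`, `q`, in binary, such that
`α * q < p`. -/
def Comparison (α : ℝ) : Language Sym :=
  {w | ∃ p q : ℕ, natCode p ++ Sym.comma :: natCode q = w ∧ α * q < p}

/-! ### Different instances have different codes -/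

theorem append_cons_inj {x : Sym} : ∀ {a a' b b' : List Sym}, x ∉ a → x ∉ a' →
    a ++ x :: b = a' ++ x :: b' → a = a' ∧ b = b'
  | [], [], _, _, _, _, h => by simpa using h
  | [], y :: a', _, _, _, h', h => by simp_all
  | y :: a, [], _, _, h', _, h => by simp_all
  | y :: a, y' :: a', b, b', h1, h2, h => by
    simp only [List.mem_cons, not_or, List.cons_append, List.cons.injEq] at h1 h2 h
    obtain ⟨e1, e2⟩ := append_cons_inj h1.2 h2.2 h.2
    exact ⟨by rw [h.1, e1], e2⟩

theorem flatMap_injective {β : Type} {f : β → List Sym} {x : Sym} (hf : Function.Injective f)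
    (hx : ∀ b, x ∉ f b) : Function.Injective fun l : List β => l.flatMap fun b => f b ++ [x] := by
  intro l
  induction l with
  | nil => intro l' h; cases l' <;> simp_all
  | cons a l ih =>
    intro l' h
    cases l' with
    | nil => simp at h
    | cons a' l' =>
      simp only [List.flatMap_cons, List.append_assoc, List.singleton_append] at h
      obtain ⟨e1, e2⟩ := append_cons_inj (hx a) (hx a') h
      rw [hf e1, ih e2]

theorem natCode_injective : Function.Injective natCode := by
  intro a b h
  have hb : a.bits = b.bits :=
    List.map_injective_iff.2 (fun _ _ h => by simpa using h) h
  have h2 : Nat.digits 2 a = Nat.digits 2 b := by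
    rw [Nat.digits_two_eq_bits, Nat.digits_two_eq_bits, hb]
  exact Nat.digits_inj_iff.1 h2

theorem intCode_injective : Function.Injective intCode := by
  have hm : ∀ n l, natCode n ≠ Sym.minus :: l := by
    intro n l h
    have : Sym.minus ∈ natCode n := by simp [h]
    simp [natCode] at this
  intro a b h
  unfold intCode at h
  split_ifs at h with h1 h2 h2
  · have := natCode_injective (List.cons.inj h).2
    omega
  · exact absurd h.symm (hm _ _)
  · exact absurd h (hm _ _)
  · have := natCode_injective h
    omega

theorem mem_intCode {x : Sym} {z : ℤ} (h : x ∈ intCode z) :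
    x ≠ Sym.comma ∧ x ≠ Sym.semicolon ∧ x ≠ Sym.bar := by
  unfold intCode natCode at h
  split_ifs at h <;> grind

theorem mem_rowCode {x : Sym} {r : List ℤ} (h : x ∈ rowCode r) :
    x ≠ Sym.semicolon ∧ x ≠ Sym.bar := by
  simp only [rowCode, List.mem_flatMap, List.mem_append, List.mem_singleton] at h
  obtain ⟨z, -, h | rfl⟩ := h
  · exact (mem_intCode h).2
  · simp

theorem bar_notMem_rowsCode (R : List (List ℤ)) : Sym.bar ∉ rowsCode R := by
  intro h
  simp only [rowsCode, List.mem_flatMap, List.mem_append, List.mem_singleton] at h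
  obtain ⟨r, -, h | h⟩ := h
  · exact (mem_rowCode h).2 rfl
  · cases h

theorem rowsCode_injective : Function.Injective rowsCode :=
  flatMap_injective
    (flatMap_injective intCode_injective fun _ h => (mem_intCode h).1 rfl)
    fun _ h => (mem_rowCode h).1 rfl

theorem Instance.code_injective : Function.Injective Instance.code := by
  rintro ⟨n, m, u, v, i⟩ ⟨n', m', u', v', i'⟩ h
  obtain ⟨h1, h⟩ := append_cons_inj (bar_notMem_rowsCode _) (bar_notMem_rowsCode _) h
  obtain ⟨h2, h3⟩ := append_cons_inj (bar_notMem_rowsCode _) (bar_notMem_rowsCode _) h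
  have h1 := rowsCode_injective h1
  have h2 := rowsCode_injective h2
  have h4 : (i : ℕ) = i' := natCode_injective h3
  clear h3
  simp only [rows] at h1 h2
  have hn : n = n' := by simpa using congrArg List.length h1
  subst hn
  have h1 := List.ofFn_injective h1
  have h2 := List.ofFn_injective h2
  have hm : m = m' := by simpa using congrArg List.length (congrFun h1 i)
  subst hm
  have e1 : u = u' := funext fun j => List.ofFn_injective (congrFun h1 j)
  have e2 : v = v' := funext fun j => List.ofFn_injective (congrFun h2 j)
  subst e1 e2
  obtain rfl : i = i' := Fin.ext h4
  rfl

end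

end QV

namespace QV

open Turing

/-! ### Binary trees and their codes -/

/-! Fix the other ballots and let `t o` be the number of votes that `o` has from them. A deviation
matters only through the set `W` of winners it creates, their common level `K`, and its price. The
cheapest ballot for `W` and `K` casts `K - t o` votes for a winner and `min 0 (K - t o - 1)` for a
loser, so by `hasBeneficialDeviation_iff` it remains to decide whether some pair `W`, `K` is
`Better`. The price is a sum over all outcomes that does not involve `W`, plus `winCost (K - t o)`
summed over the winners. For a fixed number `k` of winners and fixed `K`, a best `W` therefore
consists of `k` outcomes of largest `quality`.

There are exponentially many levels, but `winCost` is convex, so the difference of two qualities is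
monotone in `K` and every strict comparison of two outcomes changes at most once. The change points,
one for each ordered pair and found by bisection, yield every order that occurs
(`exists_threshold`), hence a polynomial list of candidate sets. For one candidate the price is
convex in `K`, so another bisection finds the best level (`bestLevel_le`); `exists_clamp` confines
the levels to a bounded interval. `improves_iff` combines these facts.

To obtain a Turing machine, functions between types coded by binary trees are shown to be closed
under composition, pairing, case distinction and folds with polynomially small intermediate values
(`PT.foldl`); `PT.inP` turns such a program into a machine. Programs may call a fixed machine as a
subroutine, which is how a comparison procedure for `α` enters (`InP.exists_PT`). The search uses
`α` only through tests `α * Y < X` with integers: a rational `α` is handled by cross-multiplication,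
and for an irrational `α` the case of negative `Y` reduces to natural numbers because equality
cannot occur. -/

/-- Binary trees, the universal data type of the machines below. -/
inductive D : Type
  | nil
  | cons (a b : D)

namespace D

/-- The prefix code of a tree. -/
def code : D → List Bool
  | nil => [false]
  | cons a b => true :: (a.code ++ b.code)

/-- The length of the code of a tree. -/
def size : D → ℕ
  | nil => 1
  | cons a b => a.size + b.size + 1

@[simp] theorem length_code (d : D) : d.code.length = d.size := by
  induction d with
  | nil => rfl
  | cons a b iha ihb => simp [code, size, iha, ihb]

theorem size_pos (d : D) : 0 < d.size := by cases d <;> simp [size]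

end D

/-! ### Machines with a subroutine -/

/-- The position of a symbol in the list of all symbols. -/
def Sym.index : Sym → ℕ
  | .bit false => 0
  | .bit true => 1
  | .minus => 2
  | .comma => 3
  | .semicolon => 4
  | .bar => 5

theorem Sym.index_injective : Function.Injective Sym.index := by
  rintro ((_ | _) | _ | _ | _ | _) ((_ | _) | _ | _ | _ | _) <;> simp [Sym.index]

instance : DecidableEq Sym := Sym.index_injective.decidableEq

/-- The list of all symbols. -/
def Sym.all : List Sym := [.bit false, .bit true, .minus, .comma, .semicolon, .bar]

instance : Fintype Sym where
  elems := Sym.all.toFinset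
  complete := by rintro ((_ | _) | _ | _ | _ | _) <;> simp [Sym.all]

/-- The stacks of the machines below, besides those of the subroutine. -/
inductive Stk : Type
  | inp | main | a | b | c | out
  deriving DecidableEq

instance : Fintype Stk where
  elems := {.inp, .main, .a, .b, .c, .out}
  complete := by rintro (_ | _ | _ | _ | _ | _) <;> simp

section Machine

variable (tm : FinTM2)

/-- The alphabets of the stacks. -/
@[reducible] def StkAlph : Stk ⊕ tm.K → Type
  | .inl .inp => Sym
  | .inl .main => Bool
  | .inl .a => Bool
  | .inl .b => Bool
  | .inl .c => Bool
  | .inl .out => Bool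
  | .inr k => tm.Γ k

/-- The internal states. -/
abbrev Reg : Type := Option Sym × tm.σ

/-- Statements with labels in `Λ`. -/
abbrev Code (Λ : Type) : Type := TM2.Stmt (StkAlph tm) Λ (Reg tm)

/-- Store a bit in the register. -/
def readBit (r : Reg tm) (o : Option Bool) : Reg tm := (o.map .bit, r.2)

variable {tm} in
/-- The bit in the register. -/
def topBit (r : Reg tm) : Bool := decide (r.1 = some (.bit true))

/-- Configurations with labels in `Λ`. -/
abbrev Conf (Λ : Type) : Type := TM2.Cfg (StkAlph tm) Λ (Reg tm)

/-- The contents of all stacks. -/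
structure Store : Type where
  inp : List Sym := []
  main : List Bool := []
  a : List Bool := []
  b : List Bool := []
  c : List Bool := []
  out : List Bool := []
  sub : ∀ k, List (tm.Γ k) := fun _ => []

variable {tm}

/-- The contents of the stacks as a function of the stack. -/
def Store.get (S : Store tm) : ∀ k, List (StkAlph tm k)
  | .inl .inp => S.inp
  | .inl .main => S.main
  | .inl .a => S.a
  | .inl .b => S.b
  | .inl .c => S.c
  | .inl .out => S.out
  | .inr k => S.sub k

section update

variable (S : Store tm)

@[simp] theorem get_inp : S.get (.inl .inp) = S.inp := rfl
@[simp] theorem get_main : S.get (.inl .main) = S.main := rfl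
@[simp] theorem get_a : S.get (.inl .a) = S.a := rfl
@[simp] theorem get_b : S.get (.inl .b) = S.b := rfl
@[simp] theorem get_c : S.get (.inl .c) = S.c := rfl
@[simp] theorem get_out : S.get (.inl .out) = S.out := rfl
@[simp] theorem get_sub (k : tm.K) : S.get (.inr k) = S.sub k := rfl

-- With these rules `simp` evaluates a statement on a `Store` symbolically, which proves the
-- execution lemmas for single statements.
@[simp] theorem update_inp (l : List Sym) :
    Function.update S.get (.inl .inp) l = Store.get { S with inp := l } := by
  funext k; rcases k with (_ | _ | _ | _ | _ | _) | k <;> simp [Function.update]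

@[simp] theorem update_main (l : List Bool) :
    Function.update S.get (.inl .main) l = Store.get { S with main := l } := by
  funext k; rcases k with (_ | _ | _ | _ | _ | _) | k <;> simp [Function.update]

@[simp] theorem update_a (l : List Bool) :
    Function.update S.get (.inl .a) l = Store.get { S with a := l } := by
  funext k; rcases k with (_ | _ | _ | _ | _ | _) | k <;> simp [Function.update]

@[simp] theorem update_b (l : List Bool) :
    Function.update S.get (.inl .b) l = Store.get { S with b := l } := by
  funext k; rcases k with (_ | _ | _ | _ | _ | _) | k <;> simp [Function.update]

@[simp] theorem update_c (l : List Bool) :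
    Function.update S.get (.inl .c) l = Store.get { S with c := l } := by
  funext k; rcases k with (_ | _ | _ | _ | _ | _) | k <;> simp [Function.update]

@[simp] theorem update_out (l : List Bool) :
    Function.update S.get (.inl .out) l = Store.get { S with out := l } := by
  funext k; rcases k with (_ | _ | _ | _ | _ | _) | k <;> simp [Function.update]

@[simp] theorem update_sub (k : tm.K) (l : List (tm.Γ k)) :
    Function.update S.get (.inr k) l = Store.get { S with sub := Function.update S.sub k l } := by
  funext j
  rcases j with (_ | _ | _ | _ | _ | _) | j
  iterate 6 simp [Function.update]
  by_cases h : j = k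
  · subst h; simp
  · simp [Function.update, h]

end update

/-- `Runs M n c c'`: the machine `M` gets from `c` to `c'` in at most `n` steps. -/
inductive Runs {Λ : Type} (M : Λ → Code tm Λ) : ℕ → Conf tm Λ → Conf tm Λ → Prop
  | refl (n : ℕ) (c : Conf tm Λ) : Runs M n c c
  | head {n : ℕ} {c c' c'' : Conf tm Λ} :
      TM2.step M c = some c' → Runs M n c' c'' → Runs M (n + 1) c c''

namespace Runs

variable {Λ : Type} {M : Λ → Code tm Λ} {c c' c'' : Conf tm Λ} {m n : ℕ}

theorem mono (h : Runs M m c c') (hmn : m ≤ n) : Runs M n c c' := by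
  induction h generalizing n with
  | refl k c => exact .refl _ _
  | head hs _ ih =>
    cases n with
    | zero => omega
    | succ n => exact .head hs (ih (by omega))

theorem trans (h : Runs M m c c') (h' : Runs M n c' c'') : Runs M (m + n) c c'' := by
  induction h with
  | refl k c =>
    exact h'.mono (Nat.le_add_left _ _)
  | head hs _ ih =>
    rw [Nat.add_right_comm]; exact .head hs (ih h')

theorem single (h : TM2.step M c = some c') : Runs M 1 c c' := .head h (.refl 0 _)

end Runs

/-- A configuration between two fragments of a program. -/
def conf {Λ : Type} (l : Λ) (r : Option Sym) (S : Store tm) : Conf tm Λ :=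
  ⟨some l, (r, tm.initialState), S.get⟩

theorem Runs.of_code {Λ : Type} {M : Λ → Code tm Λ} {l : Λ} {r : Option Sym} {S : Store tm}
    {q : Code tm Λ} {c : Conf tm Λ} (hl : M l = q)
    (h : TM2.stepAux q (r, tm.initialState) S.get = c) : Runs M 1 (conf l r S) c :=
  .single (by rw [conf, TM2.step, hl, h])

/-! ### Program fragments and their composition -/

variable (tm) in
/-- A fragment of a program: given an embedding of its labels and the label at which to continue,
it provides code. -/
structure Frag : Type 1 where
  Λ : Type
  [fin : Fintype Λ]
  start : Λ
  code {Λ' : Type} (e : Λ → Λ') (x : Λ') : Λ → Code tm Λ'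

namespace Frag

/-- The fragment `F` turns the store `S` into `S'` in at most `n` steps. -/
def Exec (F : Frag tm) (S S' : Store tm) (n : ℕ) : Prop :=
  ∀ (Λ' : Type) (M : Λ' → Code tm Λ') (e : F.Λ → Λ') (x : Λ'),
    (∀ l, M (e l) = F.code e x l) → ∀ r, ∃ r',
      Runs M n (conf (e F.start) r S) (conf x r' S')

theorem Exec.mono {F : Frag tm} {S S' : Store tm} {m n : ℕ} (h : F.Exec S S' m) (hmn : m ≤ n) :
    F.Exec S S' n := by
  intro Λ' M e x hM r
  obtain ⟨r', h'⟩ := h Λ' M e x hM r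
  exact ⟨r', h'.mono hmn⟩

/-- Sequential composition. -/
def seq (F G : Frag tm) : Frag tm where
  Λ := F.Λ ⊕ G.Λ
  fin := @instFintypeSum _ _ F.fin G.fin
  start := .inl F.start
  code e x
    | .inl l => F.code (e ∘ .inl) (e (.inr G.start)) l
    | .inr l => G.code (e ∘ .inr) x l

/-- `Exec` quantifies over every machine that contains the fragment, so both halves can be run
inside the same larger machine. -/
theorem Exec.seq {F G : Frag tm} {S S' S'' : Store tm} {m n : ℕ} (hF : F.Exec S S' m)
    (hG : G.Exec S' S'' n) : (F.seq G).Exec S S'' (m + n) := by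
  intro Λ' M e x hM r
  obtain ⟨r', h1⟩ := hF Λ' M (e ∘ .inl) (e (.inr G.start)) (fun l => hM (.inl l)) r
  obtain ⟨r'', h2⟩ := hG Λ' M (e ∘ .inr) x (fun l => hM (.inr l)) r'
  exact ⟨r'', h1.trans h2⟩

/-- A single statement, given its continuation. -/
def prim (q : ∀ {Λ' : Type}, Code tm Λ' → Code tm Λ') : Frag tm where
  Λ := Unit
  start := ()
  code _ x _ := q (.goto fun _ => x)

theorem exec_prim {q : ∀ {Λ' : Type}, Code tm Λ' → Code tm Λ'} {S S' : Store tm}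
    (h : ∀ {Λ' : Type} (x : Λ') r, ∃ r',
      TM2.stepAux (q (.goto fun _ => x)) (r, tm.initialState) S.get = conf x r' S') :
    (prim q).Exec S S' 1 := by
  intro Λ' M e x hM r
  obtain ⟨r', h⟩ := h x r
  exact ⟨r', .of_code (hM ()) h⟩

/-- Pop a symbol from the main stack and branch. -/
def cases (F G : Frag tm) : Frag tm where
  Λ := Unit ⊕ (F.Λ ⊕ G.Λ)
  fin := @instFintypeSum _ _ _ (@instFintypeSum _ _ F.fin G.fin)
  start := .inl ()
  code e x
    | .inl _ => .pop (.inl .main) (readBit tm) <|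
        .branch topBit (.goto fun _ => e (.inr (.inl F.start))) (.goto fun _ => e (.inr (.inr G.start)))
    | .inr (.inl l) => F.code (fun l => e (.inr (.inl l))) x l
    | .inr (.inr l) => G.code (fun l => e (.inr (.inr l))) x l

theorem exec_cases_true {F G : Frag tm} {S S' : Store tm} {n : ℕ} {l : List Bool}
    (h : F.Exec { S with main := l } S' n) (hS : S.main = true :: l) :
    (cases F G).Exec S S' (n + 1) := by
  intro Λ' M e x hM r
  obtain ⟨r', h1⟩ := h Λ' M (fun l => e (.inr (.inl l))) x (fun l => hM (.inr (.inl l)))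
    (some (.bit true))
  rw [Nat.add_comm]
  exact ⟨r', .trans (.of_code (hM (.inl ())) (by simp [conf, readBit, topBit, cases, hS])) h1⟩

theorem exec_cases_false {F G : Frag tm} {S S' : Store tm} {n : ℕ} {l : List Bool}
    (h : G.Exec { S with main := l } S' n) (hS : S.main = false :: l) :
    (cases F G).Exec S S' (n + 1) := by
  intro Λ' M e x hM r
  obtain ⟨r', h1⟩ := h Λ' M (fun l => e (.inr (.inr l))) x (fun l => hM (.inr (.inr l)))
    (some (.bit false))
  rw [Nat.add_comm]
  exact ⟨r', .trans (.of_code (hM (.inl ())) (by simp [conf, readBit, topBit, cases, hS])) h1⟩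

/-- Run `F` as long as the two topmost symbols of the main stack are `true`. -/
def loop (F : Frag tm) : Frag tm where
  Λ := Unit ⊕ F.Λ
  fin := @instFintypeSum _ _ _ F.fin
  start := .inl ()
  code e x
    | .inl _ => .pop (.inl .main) (readBit tm) <|
        .branch topBit (.peek (.inl .main) (readBit tm) <| .push (.inl .main) (fun _ => true) <|
        .branch topBit (.goto fun _ => e (.inr F.start)) (.goto fun _ => x))
        (.push (.inl .main) (fun _ => false) <| .goto fun _ => x)
    | .inr l => F.code (fun l => e (.inr l)) (e (.inl ())) l

/-- The intended state is a pair whose first component is a list: the first `true` is the pair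
constructor and the next bit tells whether the list is empty. -/
theorem exec_loop_stop {F : Frag tm} {S : Store tm} {l : List Bool}
    (hS : S.main = true :: false :: l) : (F.loop).Exec S S 1 := by
  intro Λ' M e x hM r
  obtain ⟨_, _⟩ := S
  simp only at hS
  subst hS
  exact ⟨some (.bit false), .of_code (hM (.inl ())) (by simp [conf, readBit, topBit, loop])⟩

theorem exec_loop_step {F : Frag tm} {S S' S'' : Store tm} {m n : ℕ} {l : List Bool}
    (hS : S.main = true :: true :: l) (h : F.Exec S S' m) (h' : (F.loop).Exec S' S'' n) :
    (F.loop).Exec S S'' (1 + m + n) := by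
  intro Λ' M e x hM r
  obtain ⟨r', h1⟩ := h Λ' M (fun l => e (.inr l)) (e (.inl ())) (fun l => hM (.inr l))
    (some (.bit true))
  obtain ⟨r'', h2⟩ := h' Λ' M e x hM r'
  refine ⟨r'', .trans (.trans (.of_code (hM (.inl ())) ?_) h1) h2⟩
  obtain ⟨_, _⟩ := S
  simp only at hS
  subst hS
  simp [conf, readBit, topBit, loop]

end Frag

end Machine

/-! ### Moving, copying and exchanging trees on the stacks -/

section Machine

variable {tm : FinTM2}

namespace Frag

/-- Repeat a statement that ends with its first or with its second argument: the first one
repeats the statement, the second one leaves the loop. -/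
def rep (q : ∀ {Λ' : Type}, Code tm Λ' → Code tm Λ' → Code tm Λ') : Frag tm where
  Λ := Unit
  start := ()
  code e x _ := q (.goto fun _ => e ()) (.goto fun _ => x)

theorem exec_rep_stop {q : ∀ {Λ' : Type}, Code tm Λ' → Code tm Λ' → Code tm Λ'} {S S' : Store tm}
    (h : ∀ {Λ' : Type} (y x : Λ') r, ∃ r',
      TM2.stepAux (q (.goto fun _ => y) (.goto fun _ => x)) (r, tm.initialState) S.get =
        conf x r' S') :
    (rep q).Exec S S' 1 := by
  intro Λ' M e x hM r
  obtain ⟨r', h⟩ := h (e ()) x r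
  exact ⟨r', .of_code (hM ()) h⟩

theorem exec_rep_step {q : ∀ {Λ' : Type}, Code tm Λ' → Code tm Λ' → Code tm Λ'}
    {S S' S'' : Store tm} {n : ℕ}
    (h : ∀ {Λ' : Type} (y x : Λ') r, ∃ r',
      TM2.stepAux (q (.goto fun _ => y) (.goto fun _ => x)) (r, tm.initialState) S.get =
        conf y r' S')
    (h' : (rep q).Exec S' S'' n) :
    (rep q).Exec S S'' (n + 1) := by
  intro Λ' M e x hM r
  obtain ⟨r', h1⟩ := h (e ()) x r
  obtain ⟨r'', h2⟩ := h' Λ' M e x hM r'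
  rw [Nat.add_comm]
  exact ⟨r'', .trans (.of_code (hM ()) h1) h2⟩

/-- Move a tree from the main stack to the stack `a`. -/
def pullA : Frag tm := rep fun again done =>
  .pop (.inl .main) (readBit tm) <| .push (.inl .a) topBit <|
    .branch topBit (.push (.inl .c) (fun _ => true) again) <|
      .pop (.inl .c) (readBit tm) <| .branch (fun r => r.1.isNone) done again

/-- The stack `c` counts the subtrees still to be read after the current one: a `cons` adds one and
a leaf pays one off. Since `c` is nonempty, the loop goes on after `d`. -/
theorem exec_pullA_aux (d : D) {S S' : Store tm} {l c : List Bool} {y : Bool} {n : ℕ}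
    (hm : S.main = d.code ++ l) (hc : S.c = y :: c)
    (h : pullA.Exec { S with main := l, a := d.code.reverse ++ S.a, c := c } S' n) :
    pullA.Exec S S' (n + d.size) := by
  induction d generalizing S l y c n with
  | nil =>
    refine exec_rep_step (fun _ _ _ => ⟨some (.bit y), ?_⟩) h
    simp [conf, readBit, topBit, hm, hc, D.code]
  | cons d₁ d₂ ih₁ ih₂ =>
    rw [D.size, ← Nat.add_assoc]
    refine exec_rep_step (fun _ _ _ => ⟨some (.bit true), ?_⟩)
      (S' := { S with main := d₁.code ++ (d₂.code ++ l), a := true :: S.a, c := true :: S.c }) ?_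
    · simp [conf, readBit, topBit, hm, D.code]
    · rw [Nat.add_comm d₁.size, ← Nat.add_assoc]
      refine ih₁ rfl rfl (ih₂ rfl hc ?_)
      simpa [D.code] using h

/-- With an empty counter the last leaf of `d` ends the loop, so trees on the main stack need no end
markers. -/
theorem exec_pullA (d : D) {S : Store tm} {l : List Bool} (hm : S.main = d.code ++ l)
    (hc : S.c = []) :
    pullA.Exec S { S with main := l, a := d.code.reverse ++ S.a } d.size := by
  induction d generalizing S l with
  | nil =>
    refine exec_rep_stop (fun _ _ _ => ⟨none, ?_⟩)
    simp [conf, readBit, topBit, hm, hc, D.code]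
  | cons d₁ d₂ ih₁ ih₂ =>
    refine exec_rep_step (fun _ _ _ => ⟨some (.bit true), ?_⟩)
      (S' := { S with main := d₁.code ++ (d₂.code ++ l), a := true :: S.a, c := true :: S.c }) ?_
    · simp [conf, readBit, topBit, hm, D.code]
    · rw [Nat.add_comm d₁.size]
      refine exec_pullA_aux d₁ rfl rfl ?_
      simpa [D.code, hc] using ih₂ (S := { S with
        main := d₂.code ++ l, a := d₁.code.reverse ++ (true :: S.a), c := S.c }) rfl hc

/-- Move the stack `a` to the main stack. -/
def moveAMain : Frag tm := rep fun again done =>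
  .pop (.inl .a) (readBit tm) <| .branch (fun r => r.1.isNone) done <|
    .push (.inl .main) topBit again

theorem exec_moveAMain {S : Store tm} {l : List Bool} (h : S.a = l) :
    moveAMain.Exec S { S with main := l.reverse ++ S.main, a := [] } (l.length + 1) := by
  induction l generalizing S with
  | nil => exact exec_rep_stop fun _ _ _ => ⟨none, by simp [conf, readBit, topBit, h]⟩
  | cons y l ih =>
    refine exec_rep_step (fun _ _ _ => ⟨some (.bit y), ?_⟩)
      (S' := { S with main := y :: S.main, a := l }) ?_
    · cases y <;> simp [conf, readBit, topBit, h]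
    · simpa [moveAMain] using ih (S := { S with main := y :: S.main, a := l }) rfl

/-- Move the stack `a` to the stack `b`. -/
def moveAB : Frag tm := rep fun again done =>
  .pop (.inl .a) (readBit tm) <| .branch (fun r => r.1.isNone) done <|
    .push (.inl .b) topBit again

theorem exec_moveAB {S : Store tm} {l : List Bool} (h : S.a = l) :
    moveAB.Exec S { S with b := l.reverse ++ S.b, a := [] } (l.length + 1) := by
  induction l generalizing S with
  | nil => exact exec_rep_stop fun _ _ _ => ⟨none, by simp [conf, readBit, topBit, h]⟩
  | cons y l ih =>
    refine exec_rep_step (fun _ _ _ => ⟨some (.bit y), ?_⟩)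
      (S' := { S with b := y :: S.b, a := l }) ?_
    · cases y <;> simp [conf, readBit, topBit, h]
    · simpa [moveAB] using ih (S := { S with b := y :: S.b, a := l }) rfl

/-- Move the stack `a` to the main stack and to the stack `b`. -/
def moveAMainB : Frag tm := rep fun again done =>
  .pop (.inl .a) (readBit tm) <| .branch (fun r => r.1.isNone) done <|
    .push (.inl .main) topBit <| .push (.inl .b) topBit again

theorem exec_moveAMainB {S : Store tm} {l : List Bool} (h : S.a = l) :
    moveAMainB.Exec S { S with main := l.reverse ++ S.main, b := l.reverse ++ S.b, a := [] }
      (l.length + 1) := by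
  induction l generalizing S with
  | nil => exact exec_rep_stop fun _ _ _ => ⟨none, by simp [conf, readBit, topBit, h]⟩
  | cons y l ih =>
    refine exec_rep_step (fun _ _ _ => ⟨some (.bit y), ?_⟩)
      (S' := { S with main := y :: S.main, b := y :: S.b, a := l }) ?_
    · cases y <;> simp [conf, readBit, topBit, h]
    · simpa [moveAMainB] using ih (S := { S with main := y :: S.main, b := y :: S.b, a := l }) rfl

/-- Move the stack `b` to the stack `c`. -/
def moveBC : Frag tm := rep fun again done =>
  .pop (.inl .b) (readBit tm) <| .branch (fun r => r.1.isNone) done <|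
    .push (.inl .c) topBit again

theorem exec_moveBC {S : Store tm} {l : List Bool} (h : S.b = l) :
    moveBC.Exec S { S with c := l.reverse ++ S.c, b := [] } (l.length + 1) := by
  induction l generalizing S with
  | nil => exact exec_rep_stop fun _ _ _ => ⟨none, by simp [conf, readBit, topBit, h]⟩
  | cons y l ih =>
    refine exec_rep_step (fun _ _ _ => ⟨some (.bit y), ?_⟩)
      (S' := { S with c := y :: S.c, b := l }) ?_
    · cases y <;> simp [conf, readBit, topBit, h]
    · simpa [moveBC] using ih (S := { S with c := y :: S.c, b := l }) rfl

/-- Move the stack `c` to the main stack. -/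
def moveCMain : Frag tm := rep fun again done =>
  .pop (.inl .c) (readBit tm) <| .branch (fun r => r.1.isNone) done <|
    .push (.inl .main) topBit again

theorem exec_moveCMain {S : Store tm} {l : List Bool} (h : S.c = l) :
    moveCMain.Exec S { S with main := l.reverse ++ S.main, c := [] } (l.length + 1) := by
  induction l generalizing S with
  | nil => exact exec_rep_stop fun _ _ _ => ⟨none, by simp [conf, readBit, topBit, h]⟩
  | cons y l ih =>
    refine exec_rep_step (fun _ _ _ => ⟨some (.bit y), ?_⟩)
      (S' := { S with main := y :: S.main, c := l }) ?_
    · cases y <;> simp [conf, readBit, topBit, h]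
    · simpa [moveCMain] using ih (S := { S with main := y :: S.main, c := l }) rfl

/-- Clear the stack `a`. -/
def clearA : Frag tm := rep fun again done =>
  .pop (.inl .a) (readBit tm) <| .branch (fun r => r.1.isNone) done again

theorem exec_clearA {S : Store tm} {l : List Bool} (h : S.a = l) :
    clearA.Exec S { S with a := [] } (l.length + 1) := by
  induction l generalizing S with
  | nil => exact exec_rep_stop fun _ _ _ => ⟨none, by simp [conf, readBit, h]⟩
  | cons y l ih =>
    refine exec_rep_step (fun _ _ _ => ⟨some (.bit y), ?_⟩)
      (S' := { S with a := l }) ?_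
    · cases y <;> simp [conf, readBit, h]
    · simpa [clearA] using ih (S := { S with a := l }) rfl

/-- Remove a tree from the main stack. -/
def drop : Frag tm := pullA.seq clearA

/-- Duplicate a tree on the main stack. -/
def dup : Frag tm := pullA.seq (moveAMainB.seq (moveBC.seq moveCMain))

/-- Exchange two trees on the main stack. -/
def swap : Frag tm := pullA.seq (moveAB.seq (pullA.seq (moveBC.seq (moveCMain.seq moveAMain))))

/-- A store that is empty except for the main stack. -/
abbrev onMain (tm : FinTM2) (l : List Bool) : Store tm := { main := l }

theorem exec_drop (d : D) (l : List Bool) :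
    drop.Exec (onMain tm (d.code ++ l)) (onMain tm l) (2 * d.size + 1) := by
  refine ((exec_pullA d rfl rfl).seq (exec_clearA rfl)).mono ?_
  simp; omega

/-- Each move reverses a word, so the second copy has to pass through both `b` and `c` to arrive in
the right order. -/
theorem exec_dup (d : D) (l : List Bool) :
    dup.Exec (onMain tm (d.code ++ l)) (onMain tm (d.code ++ (d.code ++ l)))
      (4 * d.size + 3) := by
  have := ((exec_pullA (tm := tm) (S := onMain tm (d.code ++ l)) d rfl rfl).seq
    ((exec_moveAMainB rfl).seq ((exec_moveBC rfl).seq (exec_moveCMain rfl))))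
  simp only [List.append_nil, List.reverse_reverse] at this
  refine this.mono ?_
  simp; omega

theorem exec_swap (d d' : D) (l : List Bool) :
    swap.Exec (onMain tm (d.code ++ (d'.code ++ l))) (onMain tm (d'.code ++ (d.code ++ l)))
      (4 * d.size + 2 * d'.size + 4) := by
  have := ((exec_pullA (tm := tm) (S := onMain tm (d.code ++ (d'.code ++ l))) d rfl rfl).seq
    ((exec_moveAB rfl).seq ((exec_pullA d' rfl rfl).seq
      ((exec_moveBC rfl).seq ((exec_moveCMain rfl).seq (exec_moveAMain rfl))))))
  simp only [List.append_nil, List.reverse_reverse] at this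
  refine this.mono ?_
  simp; omega

/-- Push a bit on the main stack. -/
def push (y : Bool) : Frag tm := prim fun k => .push (.inl .main) (fun _ => y) k

theorem exec_push (y : Bool) (l : List Bool) :
    (push y).Exec (onMain tm l) (onMain tm (y :: l)) 1 :=
  exec_prim fun _ r => ⟨r, by simp [conf]⟩

/-- Remove a bit from the main stack. -/
def pop : Frag tm := prim fun k => .pop (.inl .main) (readBit tm) k

theorem exec_pop (y : Bool) (l : List Bool) :
    pop.Exec (onMain tm (y :: l)) (onMain tm l) 1 :=
  exec_prim fun _ _ => ⟨some (.bit y), by simp [conf, readBit]⟩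

/-- Do nothing. -/
def skip : Frag tm := prim fun k => k

theorem exec_skip (S : Store tm) : skip.Exec S S 1 :=
  exec_prim fun _ r => ⟨r, by simp [conf]⟩

end Frag

end Machine

/-! ### Encodable types -/

/-- Types whose elements are represented by trees. -/
class Enc (α : Type) where
  enc : α → D

open Enc (enc)

/-- The size of the representation. -/
def sz {α : Type} [Enc α] (a : α) : ℕ := (enc a).size

/-- The list `[(), …, ()]` of length `n`, as a tree. -/
def D.unary : ℕ → D
  | 0 => .nil
  | n + 1 => .cons .nil (unary n)

instance : Enc Unit := ⟨fun _ => .nil⟩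

instance : Enc Bool := ⟨fun b =>
  if b then .cons (.cons .nil .nil) .nil else .cons .nil (.cons .nil .nil)⟩

instance : Enc Sym := ⟨fun s => D.unary s.index⟩

/-- The tree of a list. -/
def encList {α : Type} [Enc α] : List α → D
  | [] => .nil
  | a :: l => .cons (enc a) (encList l)

instance {α : Type} [Enc α] : Enc (List α) := ⟨encList⟩

instance {α β : Type} [Enc α] [Enc β] : Enc (α × β) := ⟨fun x => .cons (enc x.1) (enc x.2)⟩

section Enc

variable {α β : Type} [Enc α] [Enc β]

theorem enc_true : enc true = .cons (.cons .nil .nil) .nil := rfl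
theorem enc_false : enc false = .cons .nil (.cons .nil .nil) := rfl
theorem enc_nil : enc ([] : List α) = .nil := rfl
theorem enc_cons (a : α) (l : List α) : enc (a :: l) = .cons (enc a) (enc l) := rfl
theorem enc_pair (a : α) (b : β) : enc (a, b) = .cons (enc a) (enc b) := rfl

theorem sz_pos (a : α) : 0 < sz a := D.size_pos _
@[simp] theorem sz_bool (b : Bool) : sz b = 5 := by cases b <;> rfl
@[simp] theorem sz_nil : sz ([] : List α) = 1 := rfl
@[simp] theorem sz_cons (a : α) (l : List α) : sz (a :: l) = sz a + sz l + 1 := rfl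
@[simp] theorem sz_pair (a : α) (b : β) : sz (a, b) = sz a + sz b + 1 := rfl
theorem sz_prod (x : α × β) : sz x = sz x.1 + sz x.2 + 1 := rfl

end Enc

/-! ### Calling the subroutine -/

section Machine

variable {tm : FinTM2}

/-- The code of a subroutine in a larger program. -/
def liftCode {Λ' : Type} (e : tm.Λ → Λ') (x : Λ') : TM2.Stmt tm.Γ tm.Λ tm.σ → Code tm Λ'
  | .push k f q => .push (.inr k) (fun r => f r.2) (liftCode e x q)
  | .peek k f q => .peek (.inr k) (fun r o => (r.1, f r.2 o)) (liftCode e x q)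
  | .pop k f q => .pop (.inr k) (fun r o => (r.1, f r.2 o)) (liftCode e x q)
  | .load f q => .load (fun r => (r.1, f r.2)) (liftCode e x q)
  | .branch f q q' => .branch (fun r => f r.2) (liftCode e x q) (liftCode e x q')
  | .goto f => .goto fun r => e (f r.2)
  | .halt => .goto fun _ => x

/-- The configuration of a program that runs a subroutine. -/
def liftConf {Λ' : Type} (e : tm.Λ → Λ') (x : Λ') (r : Option Sym) (S : Store tm) (c : tm.Cfg) :
    Conf tm Λ' :=
  ⟨some (c.l.elim x e), (r, c.var), Store.get { S with sub := c.stk }⟩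

/-- The lifted code touches only the subroutine's share of the state and of the stacks, and halting
becomes a jump to the continuation; each step is thus mirrored exactly. -/
theorem stepAux_liftCode {Λ' : Type} (e : tm.Λ → Λ') (x : Λ') (r : Option Sym) (S : Store tm)
    (q : TM2.Stmt tm.Γ tm.Λ tm.σ) (v : tm.σ) (T : ∀ k, List (tm.Γ k)) :
    TM2.stepAux (liftCode e x q) (r, v) (Store.get { S with sub := T }) =
      liftConf e x r S (TM2.stepAux q v T) := by
  induction q generalizing v T with
  | push k f q ih => simp [liftCode, ih]
  | peek k f q ih => simp [liftCode, ih]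
  | pop k f q ih => simp [liftCode, ih]
  | load f q ih => simp [liftCode, ih]
  | branch f q q' ih ih' => cases h : f v <;> simp [liftCode, ih, ih', h]
  | goto f => simp [liftCode, liftConf]
  | halt => simp [liftCode, liftConf]

theorem flip_bind_iterate_none {σ : Type*} (f : σ → Option σ) (k : ℕ) :
    (flip bind f)^[k] none = none := by
  induction k with
  | zero => rfl
  | succ k ih => rw [Function.iterate_succ_apply]; exact ih

theorem runs_liftConf {Λ' : Type} {M : Λ' → Code tm Λ'} {e : tm.Λ → Λ'} {x : Λ'}
    (hM : ∀ l, M (e l) = liftCode e x (tm.m l)) (r : Option Sym) (S : Store tm) (k : ℕ)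
    {c c' : tm.Cfg}
    (h : (flip bind tm.step)^[k] (some c) = some c') :
    Runs M k (liftConf e x r S c) (liftConf e x r S c') := by
  induction k generalizing c with
  | zero => obtain rfl : c = c' := by simpa using h
            exact .refl _ _
  | succ k ih =>
    rw [Function.iterate_succ_apply] at h
    obtain ⟨l, v, T⟩ := c
    cases l with
    | none =>
      exact absurd ((flip_bind_iterate_none _ k).symm.trans h) (by simp)
    | some l =>
      refine .head (c' := liftConf e x r S (TM2.stepAux (tm.m l) v T)) ?_ (ih h)
      simp only [liftConf, Option.elim, TM2.step, hM]
      exact congrArg some (stepAux_liftCode e x r S _ v T)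

namespace Frag

/-- Run the subroutine. -/
def call : Frag tm where
  Λ := tm.Λ
  fin := tm.ΛFin
  start := tm.main
  code e x l := liftCode e x (tm.m l)

/-- A halted subroutine is back in its initial internal state with all stacks but the output empty,
so it can be called again once its answer has been removed. -/
theorem exec_call {l : List (tm.Γ tm.k₀)} {l' : List (tm.Γ tm.k₁)} {m : ℕ}
    (h : TM2OutputsInTime tm l (some l') m) (S : Store tm) :
    call.Exec { S with sub := (initList tm l).stk } { S with sub := (haltList tm l').stk } m := by
  intro Λ' M e x hM r
  exact ⟨r, (runs_liftConf hM r S h.steps h.evals_in_steps).mono h.steps_le_m⟩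

/-- Read a symbol from the main stack, if it is in the given list, and do something with it. -/
def readSym {Λ' : Type} (act : Sym → Code tm Λ') (q : Code tm Λ') : List Sym → Code tm Λ'
  | [] => q
  | s :: L => .pop (.inl .main) (readBit tm) <|
      .branch topBit (.pop (.inl .main) (readBit tm) (readSym act q L)) (act s)

theorem stepAux_readSym_false {Λ' : Type} (act : Sym → Code tm Λ') (q : Code tm Λ') (s : Sym)
    (L : List Sym) (S : Store tm) (l : List Bool) (r : Option Sym) :
    TM2.stepAux (readSym act q (s :: L)) (r, tm.initialState)
        (Store.get { S with main := false :: l }) =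
      TM2.stepAux (act s) (some (.bit false), tm.initialState) (Store.get { S with main := l }) := by
  rw [readSym, TM2.stepAux, TM2.stepAux]
  simp [readBit, topBit]

theorem stepAux_readSym_true {Λ' : Type} (act : Sym → Code tm Λ') (q : Code tm Λ') (s : Sym)
    (L : List Sym) (S : Store tm) (y : Bool) (l : List Bool) (r : Option Sym) :
    TM2.stepAux (readSym act q (s :: L)) (r, tm.initialState)
        (Store.get { S with main := true :: y :: l }) =
      TM2.stepAux (readSym act q L) (some (.bit y), tm.initialState)
        (Store.get { S with main := l }) := by
  rw [readSym, TM2.stepAux, TM2.stepAux]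
  simp [readBit, topBit]

/-- The code of a symbol repeats the bits `true`, `false` as often as its index says and ends with
`false`; each pair read moves one place along `Sym.all`. -/
theorem stepAux_readSym {Λ' : Type} (act : Sym → Code tm Λ') (q : Code tm Λ') (s : Sym)
    (S : Store tm) (l : List Bool) (r : Option Sym) :
    TM2.stepAux (readSym act q Sym.all) (r, tm.initialState)
        (Store.get { S with main := (enc s).code ++ l }) =
      TM2.stepAux (act s) (some (.bit false), tm.initialState) (Store.get { S with main := l }) := by
  rcases s with (_ | _) | _ | _ | _ | _ <;>
    simp only [Sym.all, enc, D.unary, D.code, Sym.index, List.cons_append, List.nil_append,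
      stepAux_readSym_true, stepAux_readSym_false]

/-- Move a word from the main stack to the input stack of the subroutine, reversing it. -/
def loadSub (t : Sym → tm.Γ tm.k₀) : Frag tm := rep fun again done =>
  .pop (.inl .main) (readBit tm) <| .branch topBit
    (readSym (fun s => .push (.inr tm.k₀) (fun _ => t s) again) again Sym.all) done

theorem exec_loadSub (t : Sym → tm.Γ tm.k₀) (w : List Sym) {S : Store tm} {l : List Bool}
    (hS : S.main = (enc w).code ++ l) :
    (loadSub t).Exec S
      { S with main := l,
               sub := Function.update S.sub tm.k₀ ((w.map t).reverse ++ S.sub tm.k₀) }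
      (w.length + 1) := by
  induction w generalizing S with
  | nil =>
    refine exec_rep_stop fun _ _ _ => ⟨some (.bit false), ?_⟩
    simp [enc_nil, D.code] at hS
    simp [conf, readBit, topBit, hS]
  | cons s w ih =>
    simp only [enc_cons, D.code, List.cons_append, List.append_assoc] at hS
    refine exec_rep_step (fun _ _ _ => ⟨some (.bit false), ?_⟩)
      (S' := { S with main := (enc w).code ++ l,
                      sub := Function.update S.sub tm.k₀ (t s :: S.sub tm.k₀) }) ?_
    · rw [TM2.stepAux, TM2.stepAux]
      simp only [get_main, hS, List.head?_cons, readBit, topBit, Option.map_some, decide_true,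
        cond_true, List.tail_cons, update_main]
      rw [stepAux_readSym _ _ s S]
      simp [conf]
    · have := ih (S := { S with main := (enc w).code ++ l,
                                sub := Function.update S.sub tm.k₀ (t s :: S.sub tm.k₀) }) rfl
      simp only [Function.update_self, Function.update_idem] at this
      simpa [loadSub] using this

/-- Move the answer of the subroutine to the main stack. -/
def unloadSub (t : tm.Γ tm.k₁ → Bool) : Frag tm := prim fun k =>
  .pop (.inr tm.k₁) (fun r o => (o.map fun y => .bit (t y), r.2)) <|
    .push (.inl .main) (fun _ => false) <| .push (.inl .main) (fun _ => false) <|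
      .push (.inl .main) (fun r => !topBit r) <| .push (.inl .main) topBit <|
        .push (.inl .main) (fun _ => true) k

end Frag

end Machine

open Frag (onMain)
/-! ### Polynomial bounds -/

section PolyBound

variable {α β : Type} [Enc α] [Enc β]

/-- The quantity `t a` is polynomially bounded in the size of `a`. -/
def PolyBound (t : α → ℕ) : Prop :=
  ∃ p : Polynomial ℕ, ∀ a, t a ≤ p.eval (sz a)

theorem eval_mono (p : Polynomial ℕ) {m n : ℕ} (h : m ≤ n) : p.eval m ≤ p.eval n := by
  rw [Polynomial.eval_eq_sum, Polynomial.eval_eq_sum]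
  exact Finset.sum_le_sum fun i _ => Nat.mul_le_mul_left _ (Nat.pow_le_pow_left h i)

namespace PolyBound

theorem of_le {s t : α → ℕ} (ht : PolyBound t) (h : ∀ a, s a ≤ t a) : PolyBound s := by
  obtain ⟨p, hp⟩ := ht
  exact ⟨p, fun a => (h a).trans (hp a)⟩

theorem const (n : ℕ) : PolyBound fun _ : α => n := ⟨.C n, fun _ => by simp⟩

theorem size : PolyBound fun a : α => sz a := ⟨.X, fun _ => by simp⟩

theorem add {s t : α → ℕ} (hs : PolyBound s) (ht : PolyBound t) :
    PolyBound fun a => s a + t a := by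
  obtain ⟨p, hp⟩ := hs
  obtain ⟨q, hq⟩ := ht
  exact ⟨p + q, fun a => by simpa using Nat.add_le_add (hp a) (hq a)⟩

theorem mul {s t : α → ℕ} (hs : PolyBound s) (ht : PolyBound t) :
    PolyBound fun a => s a * t a := by
  obtain ⟨p, hp⟩ := hs
  obtain ⟨q, hq⟩ := ht
  exact ⟨p * q, fun a => by simpa using Nat.mul_le_mul (hp a) (hq a)⟩

theorem eval {s : α → ℕ} (p : Polynomial ℕ) (hs : PolyBound s) :
    PolyBound fun a => p.eval (s a) := by
  obtain ⟨q, hq⟩ := hs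
  exact ⟨p.comp q, fun a => by simpa using eval_mono p (hq a)⟩

theorem comp {t : β → ℕ} (ht : PolyBound t) {f : α → β} (hf : PolyBound fun a => sz (f a)) :
    PolyBound fun a => t (f a) := by
  obtain ⟨p, hp⟩ := ht
  exact (hf.eval p).of_le fun a => hp _

end PolyBound

end PolyBound

/-! ### Polynomial time functions -/

/-- The function `f` is computed in polynomial time by a program that may call the
subroutine `tm`. -/
@[fun_prop]
def PT (tm : FinTM2) {α β : Type} [Enc α] [Enc β] (f : α → β) : Prop :=
  (PolyBound fun a => sz (f a)) ∧ ∃ (F : Frag tm) (t : α → ℕ), PolyBound t ∧ ∀ a l,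
    F.Exec (onMain tm ((enc a).code ++ l)) (onMain tm ((enc (f a)).code ++ l)) (t a)


namespace PT

variable {tm : FinTM2} {α β γ δ ε : Type} [Enc α] [Enc β] [Enc γ] [Enc δ] [Enc ε]

/-- Changing the type but not the tree costs nothing. In this way pairs become list cells, truth
values become pairs of lists, and integers become a sign with digits. -/
theorem of_enc_eq {f : α → β} (h : ∀ a, enc (f a) = enc a) : PT tm f :=
  ⟨PolyBound.size.of_le fun a => by simp [sz, h], Frag.skip, fun _ => 1, .const 1,
    fun a l => by rw [h]; exact Frag.exec_skip _⟩

protected theorem id : PT tm fun a : α => a := of_enc_eq fun _ => rfl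

/-- The running time of `g` is polynomial in the size of `f a`, which is why `PT` records a bound
for the output besides one for the time. -/
theorem comp {g : β → γ} {f : α → β} (hg : PT tm g) (hf : PT tm f) : PT tm fun a => g (f a) := by
  obtain ⟨bf, F, s, hs, hF⟩ := hf
  obtain ⟨bg, G, t, ht, hG⟩ := hg
  exact ⟨bg.comp bf, F.seq G, fun a => s a + t (f a), hs.add (ht.comp bf),
    fun a l => (hF a l).seq (hG _ l)⟩

theorem pair {f : α → β} {g : α → γ} (hf : PT tm f) (hg : PT tm g) :
    PT tm fun a => (f a, g a) := by
  obtain ⟨bf, F, s, hs, hF⟩ := hf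
  obtain ⟨bg, G, t, ht, hG⟩ := hg
  refine ⟨(bf.add (bg.add (.const 1))).of_le fun a => by simp [Nat.add_assoc],
    Frag.dup.seq (G.seq (Frag.swap.seq (F.seq (.push true)))),
    fun a => (4 * sz a + 3) + (t a + ((4 * sz (g a) + 2 * sz a + 4) + (s a + 1))),
    ?_, fun a l => ?_⟩
  · exact (((PolyBound.const 4).mul .size).add (.const 3)).add (ht.add
      (((((PolyBound.const 4).mul bg).add ((PolyBound.const 2).mul .size)).add (.const 4)).add
        (hs.add (.const 1))))
  · have := (Frag.exec_dup (tm := tm) (enc a) l).seq ((hG a _).seq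
      ((Frag.exec_swap (enc (g a)) (enc a) l).seq ((hF a _).seq (Frag.exec_push true _))))
    simpa [enc_pair, D.code, sz] using this

theorem fst : PT tm fun x : α × β => x.1 := by
  refine ⟨PolyBound.size.of_le fun x => by have := sz_prod x; dsimp only; omega,
    Frag.pop.seq (Frag.swap.seq Frag.drop),
    fun x => 1 + (4 * sz x + 2 * sz x + 4 + (2 * sz x + 1)), ?_, fun x l => ?_⟩
  · exact (PolyBound.const 1).add (((((PolyBound.const 4).mul .size).add
      ((PolyBound.const 2).mul .size)).add (.const 4)).add (((PolyBound.const 2).mul .size).add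
      (.const 1)))
  · obtain ⟨a, b⟩ := x
    have := (Frag.exec_pop (tm := tm) true ((enc a).code ++ ((enc b).code ++ l))).seq
      ((Frag.exec_swap (enc a) (enc b) l).seq (Frag.exec_drop (enc b) _))
    simp only [enc_pair, D.code, List.cons_append, List.append_assoc]
    refine this.mono ?_
    simp only [sz_pair]
    simp only [sz]
    omega

theorem snd : PT tm fun x : α × β => x.2 := by
  refine ⟨PolyBound.size.of_le fun x => by have := sz_prod x; dsimp only; omega,
    Frag.pop.seq Frag.drop, fun x => 1 + (2 * sz x + 1), ?_, fun x l => ?_⟩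
  · exact (PolyBound.const 1).add (((PolyBound.const 2).mul .size).add (.const 1))
  · obtain ⟨a, b⟩ := x
    have := (Frag.exec_pop (tm := tm) true ((enc a).code ++ ((enc b).code ++ l))).seq
      (Frag.exec_drop (enc a) _)
    simp only [enc_pair, D.code, List.cons_append, List.append_assoc]
    refine this.mono ?_
    simp only [sz_pair]
    simp only [sz]
    omega

/-- Push a word. -/
def pushWord : List Bool → Frag tm
  | [] => Frag.skip
  | y :: l => (pushWord l).seq (.push y)

theorem exec_pushWord (w l : List Bool) :
    (pushWord w).Exec (onMain tm l) (onMain tm (w ++ l)) (w.length + 1) := by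
  induction w with
  | nil => exact Frag.exec_skip _
  | cons y w ih => exact ih.seq (Frag.exec_push y _)

theorem const (b : β) : PT tm fun _ : α => b := by
  refine ⟨.const _, Frag.drop.seq (pushWord (enc b).code), fun a => 2 * sz a + 1 + (sz b + 1),
    (((PolyBound.const 2).mul .size).add (.const 1)).add (.const _), fun a l => ?_⟩
  refine (Frag.exec_drop (enc a) l).seq ?_
  simpa [sz] using exec_pushWord (tm := tm) (enc b).code l

theorem list_cons {f : α → β} {g : α → List β} (hf : PT tm f) (hg : PT tm g) :
    PT tm fun a => f a :: g a :=
  comp (g := fun x : β × List β => x.1 :: x.2) (of_enc_eq fun _ => rfl) (hf.pair hg)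

/-- Popping the constructor of a nonempty list leaves the codes of head and tail above that of `a`.
A pushed `true` joins head and tail to a pair, and after a swap another `true` joins `a` to it. -/
theorem list_casesOn {f : α → List β} {g : α → γ} {h : α × β × List β → γ} (hf : PT tm f)
    (hg : PT tm g) (hh : PT tm h) :
    PT tm fun a => (match f a with
      | [] => g a
      | b :: l => h (a, b, l) : γ) := by
  obtain ⟨bp, P, r, hr, hP⟩ := hf.pair (PT.id (tm := tm) (α := α))
  obtain ⟨bg, G, t, ht, hG⟩ := hg
  obtain ⟨bh, H, u, hu, hH⟩ := hh
  obtain ⟨qh, hqh⟩ := bh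
  obtain ⟨qu, hqu⟩ := hu
  have hsz : PolyBound fun a => sz a + sz (f a) + 1 := (PolyBound.size.add hf.1).add (.const 1)
  refine ⟨(bg.add (hsz.eval qh)).of_le fun a => ?_,
    P.seq (Frag.pop.seq (Frag.cases ((Frag.push true).seq (Frag.swap.seq
      ((Frag.push true).seq H))) G)),
    fun a => r a + (1 + (t a + (6 * sz a + 6 * sz (f a) + 10) + qu.eval (sz a + sz (f a) + 1))),
    hr.add ((PolyBound.const 1).add ((ht.add ((((PolyBound.const 6).mul .size).add
      ((PolyBound.const 6).mul hf.1)).add (.const 10))).add (hsz.eval qu))), fun a l => ?_⟩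
  · cases hfa : f a with
    | nil => simp only [hfa]; exact Nat.le_add_right _ _
    | cons b l =>
      simp only [hfa]
      refine (hqh (a, b, l)).trans ((eval_mono qh ?_).trans (Nat.le_add_left _ _))
      simp
  · refine (hP a l).seq ?_
    simp only [enc_pair, D.code, List.cons_append, List.append_assoc]
    refine (Frag.exec_pop true _).seq ?_
    cases hfa : f a with
    | nil =>
      exact (Frag.exec_cases_false (hG a l) rfl).mono (by omega)
    | cons b m =>
      have hu' := (hqu (a, b, m)).trans (eval_mono qu (n := sz a + sz (f a) + 1)
        (by simp [hfa]))
      have := (Frag.exec_push (tm := tm) true ((enc b).code ++ ((enc m).code ++ ((enc a).code ++ l)))).seq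
        ((Frag.exec_swap (enc (b, m)) (enc a) l).mono le_rfl |> fun h => by
          simp only [enc_pair, D.code, List.cons_append, List.append_assoc] at h
          exact h.seq ((Frag.exec_push true _).seq (by
            simpa [enc_pair, D.code] using hH (a, b, m) l)))
      simp only [enc_cons, D.code, List.cons_append, List.append_assoc]
      refine (Frag.exec_cases_true this rfl).mono ?_
      rw [hfa] at hu'
      simp only [D.size, sz_cons] at hu' ⊢
      simp only [sz] at hu' ⊢
      omega

/-- A truth value is coded as a pair of lists of which exactly one is empty, so the test is a case
distinction on the first list. -/
theorem ite {f : α → Bool} {g h : α → β} (hf : PT tm f) (hg : PT tm g) (hh : PT tm h) :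
    PT tm fun a => if f a then g a else h a := by
  have h1 : PT tm fun a => (if f a then [()] else [] : List Unit) :=
    fst.comp (comp (g := fun b : Bool =>
      ((if b then [()] else [], if b then [] else [()]) : List Unit × List Unit))
      (of_enc_eq fun b => by cases b <;> rfl) hf)
  have h2 := list_casesOn h1 hh (hg.comp (fst (α := α) (β := Unit × List Unit)))
  convert h2 using 2 with a
  cases f a <;> rfl

theorem exec_loop_foldl {F : Frag tm} {step : δ → β → δ} (T : ℕ) (w : List Bool) (l : List β)
    (d : δ)
    (h : ∀ l₁ b l₂, l = l₁ ++ b :: l₂ →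
      F.Exec (onMain tm ((enc (b :: l₂, l₁.foldl step d)).code ++ w))
        (onMain tm ((enc (l₂, step (l₁.foldl step d) b)).code ++ w)) T) :
    (Frag.loop F).Exec (onMain tm ((enc (l, d)).code ++ w))
      (onMain tm ((enc (([] : List β), l.foldl step d)).code ++ w)) (l.length * (1 + T) + 1) := by
  induction l generalizing d with
  | nil => exact (Frag.exec_loop_stop rfl).mono (by simp)
  | cons b l ih =>
    have h1 := ih (step d b) fun l₁ b' l₂ hl => h (b :: l₁) b' l₂ (by rw [hl]; rfl)
    refine (Frag.exec_loop_step (by simp [enc_pair, enc_cons, D.code]; rfl)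
      (h [] b l rfl) h1).mono ?_
    simp [Nat.add_mul]; omega

/-- The loop state carries `a` along, since every step may depend on it. A polynomial time step
alone would not suffice, as the state could double each time; `hb` bounds all intermediate states
and thereby the time of every pass. -/
theorem foldl {f : α → List β} {ini : α → δ} {step : α × δ × β → δ} (hf : PT tm f)
    (hini : PT tm ini) (hstep : PT tm step)
    (hb : ∃ q : α → ℕ, PolyBound q ∧ ∀ a l₁ l₂, f a = l₁ ++ l₂ →
      sz (l₁.foldl (fun d b => step (a, d, b)) (ini a)) ≤ q a) :
    PT tm fun a => (f a).foldl (fun d b => step (a, d, b)) (ini a) := by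
  obtain ⟨q, hq, hb⟩ := hb
  have hbody : PT tm fun x : List β × δ × α => (match x.1 with
      | [] => x
      | b :: l => (l, step (x.2.2, x.2.1, b), x.2.2) : List β × δ × α) := by
    refine list_casesOn (h := fun y : (List β × δ × α) × β × List β =>
      (y.2.2, step (y.1.2.2, y.1.2.1, y.2.1), y.1.2.2)) fst PT.id ?_
    have ha : PT tm fun y : (List β × δ × α) × β × List β => y.1.2.2 :=
      snd.comp (snd.comp fst)
    exact (snd.comp snd).pair ((hstep.comp (ha.pair ((fst.comp (snd.comp fst)).pair
      (fst.comp snd)))).pair ha)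
  obtain ⟨-, B, t, ht, hB⟩ := hbody
  obtain ⟨p, hp⟩ := ht
  obtain ⟨-, I, r, hr, hI⟩ := hf.pair (hini.pair PT.id)
  obtain ⟨bO, O, u, hu, hO⟩ := (fst (tm := tm)).comp (snd (tm := tm) (α := List β) (β := δ × α))
  have hbs : PolyBound fun a => sz (f a) + q a + sz a + 2 :=
    ((hf.1.add hq).add .size).add (.const 2)
  have hlen : ∀ l : List β, l.length ≤ sz l := fun l => by
    induction l with
    | nil => simp
    | cons b l ih => simp; omega
  have happ : ∀ l₁ l₂ : List β, sz l₂ ≤ sz (l₁ ++ l₂) := fun l₁ l₂ => by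
    induction l₁ with
    | nil => simp
    | cons b l ih => simp; omega
  obtain ⟨pu, hpu⟩ := hu
  refine ⟨hq.of_le fun a => hb a (f a) [] (by simp), I.seq (B.loop.seq O),
    fun a => r a + ((sz (f a) * (1 + p.eval (sz (f a) + q a + sz a + 2)) + 1) +
      pu.eval (sz (f a) + q a + sz a + 2)),
    hr.add (((hf.1.mul ((PolyBound.const 1).add (hbs.eval p))).add (.const 1)).add (hbs.eval pu)),
    fun a w => ?_⟩
  refine (hI a w).seq (Frag.Exec.seq ?_ ((hO ([], (f a).foldl (fun d b => step (a, d, b)) (ini a), a)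
    w).mono ?_))
  · have := exec_loop_foldl (tm := tm) (F := B) (δ := δ × α)
      (step := fun x b => (step (x.2, x.1, b), x.2)) (p.eval (sz (f a) + q a + sz a + 2)) w (f a)
      (ini a, a) ?_
    · have e : ∀ (l : List β) d, l.foldl (fun x b => (step (x.2, x.1, b), x.2)) (d, a) =
          (l.foldl (fun d b => step (a, d, b)) d, a) := fun l => by
        induction l with
        | nil => intro d; rfl
        | cons b l ih => intro d; simp [ih]
      rw [e] at this
      exact this.mono (by gcongr; exact hlen _)
    · intro l₁ b l₂ hl
      have e : ∀ (l : List β) d, l.foldl (fun x b => (step (x.2, x.1, b), x.2)) (d, a) =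
          (l.foldl (fun d b => step (a, d, b)) d, a) := fun l => by
        induction l with
        | nil => intro d; rfl
        | cons b l ih => intro d; simp [ih]
      rw [e]
      refine (hB (b :: l₂, _, a) w).mono ((hp _).trans (eval_mono p ?_))
      have h1 := hb a l₁ (b :: l₂) hl
      have h2 := happ l₁ (b :: l₂)
      rw [← hl] at h2
      simp only [sz_pair]
      omega
  · refine (hpu _).trans (eval_mono pu ?_)
    have := hb a (f a) [] (by simp)
    simp only [sz_pair, sz_nil]
    have := sz_pos (f a)
    omega

end PT

/-! ### Lists and truth values -/

theorem sz_append {α : Type} [Enc α] (l l' : List α) : sz (l ++ l') + 1 = sz l + sz l' := by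
  induction l with
  | nil => simp; omega
  | cons a l ih => simp; omega

theorem sz_le_of_mem {α : Type} [Enc α] {a : α} {l : List α} (h : a ∈ l) : sz a ≤ sz l := by
  induction l with
  | nil => simp at h
  | cons b l ih =>
    simp only [sz_cons]
    rcases List.mem_cons.1 h with rfl | h
    · omega
    · have := ih h; omega

theorem length_le_sz {α : Type} [Enc α] (l : List α) : l.length ≤ sz l := by
  induction l with
  | nil => simp
  | cons b l ih => simp; omega

theorem PolyBound.fst {α β : Type} [Enc α] [Enc β] : PolyBound fun x : α × β => sz x.1 :=
  PolyBound.size.of_le fun x => by have := sz_prod x; omega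

theorem PolyBound.snd {α β : Type} [Enc α] [Enc β] : PolyBound fun x : α × β => sz x.2 :=
  PolyBound.size.of_le fun x => by have := sz_prod x; omega

namespace PT

attribute [fun_prop] PT.id PT.const PT.comp PT.pair PT.list_cons

variable {tm : FinTM2} {α β γ δ ε : Type} [Enc α] [Enc β] [Enc γ] [Enc δ] [Enc ε]

@[fun_prop]
theorem prod_fst {f : α → β × γ} (hf : PT tm f) : PT tm fun a => (f a).1 := fst.comp hf

@[fun_prop]
theorem prod_snd {f : α → β × γ} (hf : PT tm f) : PT tm fun a => (f a).2 := snd.comp hf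

@[fun_prop]
theorem decide_eq_true {f : α → Bool} (hf : PT tm f) : PT tm fun a => decide (f a = true) := by
  simpa using hf

@[fun_prop]
theorem ite_prop {p : α → Prop} [DecidablePred p] {g h : α → β}
    (hp : PT tm fun a => decide (p a)) (hg : PT tm g) (hh : PT tm h) :
    PT tm fun a => if p a then g a else h a := by
  simpa using hp.ite hg hh

@[fun_prop]
theorem not {f : α → Bool} (hf : PT tm f) : PT tm fun a => !(f a) := by
  convert hf.ite (const false) (const true) using 2 with a
  cases f a <;> rfl

@[fun_prop]
theorem and {f g : α → Bool} (hf : PT tm f) (hg : PT tm g) : PT tm fun a => f a && g a := by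
  convert hf.ite hg (const false) using 2 with a
  cases f a <;> rfl

@[fun_prop]
theorem or {f g : α → Bool} (hf : PT tm f) (hg : PT tm g) : PT tm fun a => f a || g a := by
  convert hf.ite (const true) hg using 2 with a
  cases f a <;> rfl

/-- A fold whose state grows by a bounded amount in every step. -/
theorem foldl_of_growth {f : α → List β} {ini : α → δ} {step : α → δ → β → δ} (hf : PT tm f)
    (hini : PT tm ini) (hstep : PT tm fun x : α × δ × β => step x.1 x.2.1 x.2.2)
    (q : α × β → ℕ) (hq : PolyBound q) (hb : ∀ a d b, sz (step a d b) ≤ sz d + q (a, b)) :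
    PT tm fun a => (f a).foldl (step a) (ini a) := by
  obtain ⟨p, hp⟩ := hq
  refine foldl (step := fun x : α × δ × β => step x.1 x.2.1 x.2.2) hf hini hstep
    ⟨fun a => sz (ini a) + sz (f a) * p.eval (sz a + sz (f a) + 1), hini.1.add (hf.1.mul
      (((PolyBound.size.add hf.1).add (.const 1)).eval p)), fun a l₁ l₂ hl => ?_⟩
  have key : ∀ (l : List β) (d : δ), (∀ b ∈ l, b ∈ f a) → sz (l.foldl (step a) d) ≤
      sz d + l.length * p.eval (sz a + sz (f a) + 1) := fun l => by
    induction l with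
    | nil => intro d _; simp
    | cons b l ih =>
      intro d hmem
      have h1 := ih (step a d b) fun b' hb' => hmem b' (List.mem_cons_of_mem _ hb')
      have h2 := hb a d b
      have h3 := (hp (a, b)).trans (eval_mono p (n := sz a + sz (f a) + 1) (by
        have := sz_le_of_mem (hmem b List.mem_cons_self)
        simp only [sz_pair]; omega))
      simp only [List.foldl_cons, List.length_cons, Nat.add_mul, Nat.one_mul]
      omega
  refine (key l₁ (ini a) fun b hb => by rw [hl]; exact List.mem_append_left _ hb).trans ?_
  dsimp only
  gcongr
  refine le_trans ?_ (length_le_sz (f a))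
  rw [hl]; simp

@[fun_prop]
theorem reverse {f : α → List β} (hf : PT tm f) : PT tm fun a => (f a).reverse := by
  have := foldl_of_growth (tm := tm) (δ := List β) (step := fun (_ : α) d b => b :: d)
    (ini := fun _ => []) hf (const _) (by fun_prop) (fun x => sz x.2 + 1)
    (PolyBound.snd.add (.const 1)) (fun a d b => by simp; omega)
  convert this using 2 with a
  rw [← List.foldr_reverse]; simp

theorem foldr_of_growth {f : α → List β} {ini : α → δ} {step : α → β → δ → δ} (hf : PT tm f)
    (hini : PT tm ini) (hstep : PT tm fun x : α × β × δ => step x.1 x.2.1 x.2.2)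
    (q : α × β → ℕ) (hq : PolyBound q) (hb : ∀ a b d, sz (step a b d) ≤ sz d + q (a, b)) :
    PT tm fun a => (f a).foldr (step a) (ini a) := by
  have := foldl_of_growth (tm := tm) (step := fun a d b => step a b d) hf.reverse hini
    (hstep.comp (f := fun x : α × δ × β => (x.1, x.2.2, x.2.1)) (by fun_prop)) q hq
    (fun a d b => hb a b d)
  simpa [List.foldl_reverse] using this

/-- A fold whose state has bounded size. -/
theorem foldr_of_bound {f : α → List β} {ini : α → δ} {step : α → β → δ → δ} (hf : PT tm f)
    (hini : PT tm ini) (hstep : PT tm fun x : α × β × δ => step x.1 x.2.1 x.2.2)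
    (n : ℕ) (hb : ∀ a b d, sz (step a b d) ≤ n) :
    PT tm fun a => (f a).foldr (step a) (ini a) :=
  foldr_of_growth hf hini hstep (fun _ => n) (.const n)
    fun a b d => (hb a b d).trans (Nat.le_add_left _ _)

@[fun_prop]
theorem append {f g : α → List β} (hf : PT tm f) (hg : PT tm g) :
    PT tm fun a => f a ++ g a := by
  have := foldr_of_growth (tm := tm) (δ := List β) (step := fun (_ : α) b d => b :: d)
    (ini := g) hf hg (by fun_prop) (fun x => sz x.2 + 1)
    (PolyBound.snd.add (.const 1)) (fun a d b => by simp; omega)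
  simpa using this

@[fun_prop]
theorem map {f : α → List β} {g : α → β → γ} (hf : PT tm f)
    (hg : PT tm fun x : α × β => g x.1 x.2) : PT tm fun a => (f a).map (g a) := by
  have := foldr_of_growth (tm := tm) (δ := List γ) (step := fun (a : α) b d => g a b :: d)
    (ini := fun _ => []) hf (const _)
    ((hg.comp (f := fun x : α × β × List γ => (x.1, x.2.1)) (by fun_prop)).list_cons (by fun_prop))
    (fun x => sz (g x.1 x.2) + 1) (hg.1.add (.const 1)) (fun a b d => by simp; omega)
  convert this using 2 with a
  induction f a with
  | nil => rfl
  | cons b l ih => simp only [List.map_cons, List.foldr_cons, ih]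

@[fun_prop]
theorem flatMap {f : α → List β} {g : α → β → List γ} (hf : PT tm f)
    (hg : PT tm fun x : α × β => g x.1 x.2) : PT tm fun a => (f a).flatMap (g a) := by
  have := foldr_of_growth (tm := tm) (δ := List γ) (step := fun (a : α) b d => g a b ++ d)
    (ini := fun _ => []) hf (const _)
    ((hg.comp (f := fun x : α × β × List γ => (x.1, x.2.1)) (by fun_prop)).append (by fun_prop))
    (fun x => sz (g x.1 x.2)) hg.1 (fun a b d => by have := sz_append (g a b) d; dsimp only; omega)
  convert this using 2 with a
  induction f a with
  | nil => rfl
  | cons b l ih => simp [ih]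

@[fun_prop]
theorem filter {f : α → List β} {p : α → β → Bool} (hf : PT tm f)
    (hp : PT tm fun x : α × β => p x.1 x.2) : PT tm fun a => (f a).filter (p a) := by
  have := foldr_of_growth (tm := tm) (δ := List β)
    (step := fun (a : α) b d => if p a b then b :: d else d) (ini := fun _ => []) hf (const _)
    ((hp.comp (f := fun x : α × β × List β => (x.1, x.2.1)) (by fun_prop)).ite
      (by fun_prop) (by fun_prop))
    (fun x => sz x.2 + 1) (PolyBound.snd.add (.const 1)) (fun a b d => by split <;> simp; omega)
  convert this using 2 with a
  induction f a with
  | nil => rfl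
  | cons b l ih => simp [List.filter_cons, ih]

@[fun_prop]
theorem any {f : α → List β} {p : α → β → Bool} (hf : PT tm f)
    (hp : PT tm fun x : α × β => p x.1 x.2) : PT tm fun a => (f a).any (p a) := by
  have := foldr_of_bound (tm := tm) (δ := Bool)
    (step := fun (a : α) b d => p a b || d) (ini := fun _ => false) hf (const _)
    ((hp.comp (f := fun x : α × β × Bool => (x.1, x.2.1)) (by fun_prop)).or (by fun_prop))
    5 (fun a b d => (sz_bool _).le)
  convert this using 2 with a
  induction f a with
  | nil => rfl
  | cons b l ih => simp [ih]

@[fun_prop]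
theorem all {f : α → List β} {p : α → β → Bool} (hf : PT tm f)
    (hp : PT tm fun x : α × β => p x.1 x.2) : PT tm fun a => (f a).all (p a) := by
  convert (hf.any (p := fun a b => !p a b) hp.not).not using 2 with a
  simp [List.all_eq_not_any_not]

@[fun_prop]
theorem headD {f : α → List β} {g : α → β} (hf : PT tm f) (hg : PT tm g) :
    PT tm fun a => (f a).headD (g a) := by
  convert list_casesOn (h := fun x : α × β × List β => x.2.1) hf hg (by fun_prop) using 2 with a
  cases f a <;> rfl

@[fun_prop]
theorem tail {f : α → List β} (hf : PT tm f) : PT tm fun a => (f a).tail := by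
  convert list_casesOn (h := fun x : α × β × List β => x.2.2) hf hf (by fun_prop) using 2 with a
  cases h : f a <;> simp

@[fun_prop]
theorem isEmpty {f : α → List β} (hf : PT tm f) : PT tm fun a => (f a).isEmpty := by
  convert list_casesOn (h := fun x : α × β × List β => false) hf (const true) (by fun_prop)
    using 2 with a
  cases f a <;> rfl

end PT

/-! ### Symbols -/

namespace PT

variable {tm : FinTM2} {α β : Type} [Enc α] [Enc β]

/-- A function of a symbol, computed case by case. -/
theorem sym_cases {f : α → Sym} {g : α → Sym → β} (hf : PT tm f) (hg : ∀ s, PT tm fun a => g a s) :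
    PT tm fun a => g a (f a) := by
  have h1 : PT tm fun a => List.replicate (f a).index () :=
    comp (g := fun s : Sym => List.replicate s.index ()) (of_enc_eq fun s => by
      rcases s with (_ | _) | _ | _ | _ | _ <;> rfl) hf
  -- The length of a unary list selects an entry of the table `t` by repeated emptiness tests; the
  -- default is not reached for the index of a symbol in `Sym.all`.
  have e : ∀ (k : α → List Unit), PT tm k → ∀ t : List Sym, ∀ d : Sym,
      PT tm fun a => g a (t.getD (k a).length d) := by
    intro k hk t d
    induction t generalizing k with
    | nil => exact hg d
    | cons s t ih =>
      convert (hk.isEmpty).ite (hg s) (ih _ hk.tail) using 2 with a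
      cases k a <;> simp
  convert e _ h1 Sym.all .bar using 2 with a
  rcases f a with (_ | _) | _ | _ | _ | _ <;> rfl

theorem decide_sym_eq {f : α → Sym} (hf : PT tm f) (s : Sym) :
    PT tm fun a => decide (f a = s) :=
  sym_cases (g := fun _ s' => decide (s' = s)) hf fun _ => const _

end PT

/-! ### From programs to machines -/

section Wrapper

variable {tm : FinTM2}

namespace Frag

/-- Push a word in front of a statement. -/
def pushAll {Λ' : Type} : List Bool → Code tm Λ' → Code tm Λ'
  | [], q => q
  | y :: l, q => pushAll l (.push (.inl .main) (fun _ => y) q)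

theorem stepAux_pushAll {Λ' : Type} (l : List Bool) (q : Code tm Λ') (r : Reg tm) (S : Store tm) :
    TM2.stepAux (pushAll l q) r S.get =
      TM2.stepAux q r (Store.get { S with main := l ++ S.main }) := by
  induction l generalizing q with
  | nil => rfl
  | cons y l ih => rw [pushAll, ih]; simp

/-- Push the symbol in the register, if it is in the given list. -/
def pushSym {Λ' : Type} (q : Code tm Λ') : List Sym → Code tm Λ'
  | [] => q
  | s :: L => .branch (fun r => decide (r.1 = some s)) (pushAll (true :: (enc s).code) q)
      (pushSym q L)

theorem stepAux_pushSym {Λ' : Type} (q : Code tm Λ') (s : Sym) (S : Store tm) (L : List Sym)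
    (h : s ∈ L) :
    TM2.stepAux (pushSym q L) (some s, tm.initialState) S.get =
      TM2.stepAux q (some s, tm.initialState)
        (Store.get { S with main := true :: ((enc s).code ++ S.main) }) := by
  induction L with
  | nil => simp at h
  | cons s' L ih =>
    rw [pushSym, TM2.stepAux]
    by_cases e : s = s'
    · subst e; simp [stepAux_pushAll]
    · rw [decide_eq_false (by simpa using e)]
      exact ih (by simpa [e] using h)

/-- Move the input to the main stack, reversing it. -/
def readInput : Frag tm := rep fun again done =>
  .pop (.inl .inp) (fun r o => (o, r.2)) <| .branch (fun r => r.1.isNone) done (pushSym again Sym.all)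

theorem exec_readInput (w w' : List Sym) :
    readInput.Exec { inp := w, main := (enc w').code }
      (onMain tm (enc (w.reverse ++ w')).code) (w.length + 1) := by
  induction w generalizing w' with
  | nil => exact exec_rep_stop fun _ _ _ => ⟨none, by simp [conf]⟩
  | cons s w ih =>
    refine exec_rep_step (fun _ _ _ => ⟨some s, ?_⟩)
      (S' := { inp := w, main := (enc (s :: w')).code }) ?_
    · rw [TM2.stepAux, TM2.stepAux]
      simp only [get_inp, List.head?_cons, Option.isNone_some, cond_false, update_inp,
        List.tail_cons]
      rw [stepAux_pushSym _ _ _ _ (by rcases s with (_ | _) | _ | _ | _ | _ <;> simp [Sym.all])]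
      simp [conf, enc_cons, D.code]
    · simpa [readInput] using ih (s :: w')

/-- Move the answer from the main stack to the output stack. -/
def writeOutput : Frag tm := prim fun k =>
  .pop (.inl .main) (readBit tm) <| .pop (.inl .main) (readBit tm) <|
    .push (.inl .out) topBit <| .pop (.inl .main) (fun r _ => r) <|
      .pop (.inl .main) (fun r _ => r) <| .pop (.inl .main) (fun r _ => r) k

theorem exec_writeOutput (y : Bool) :
    writeOutput.Exec (onMain tm (enc y).code) { out := [y] } 1 :=
  exec_prim fun _ _ => ⟨some (.bit y), by
    cases y <;> simp [conf, readBit, topBit, enc_true, enc_false, D.code]⟩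

end Frag

/-- The machine that runs a fragment of a program. -/
def Frag.toFinTM2 (F : Frag tm) : FinTM2 :=
  haveI := tm.kFin
  haveI := tm.σFin
  haveI := F.fin
  { K := Stk ⊕ tm.K
    k₀ := .inl .inp
    k₁ := .inl .out
    Γ := StkAlph tm
    Λ := Option F.Λ
    main := some F.start
    σ := Reg tm
    initialState := (none, tm.initialState)
    Γk₀Fin := inferInstanceAs (Fintype Sym)
    m := fun l => match l with
      | some l => F.code some none l
      -- A halting configuration must have the initial internal state, so the register is reset.
      | none => .load (fun r => (none, r.2)) .halt }

theorem Runs.evalsTo {Λ : Type} {M : Λ → Code tm Λ} {n : ℕ} {c c' : Conf tm Λ}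
    (h : Runs M n c c') : ∃ k ≤ n, (flip bind (TM2.step M))^[k] (some c) = some c' := by
  induction h with
  | refl n c => exact ⟨0, Nat.zero_le _, rfl⟩
  | head hs _ ih =>
    obtain ⟨k, hk, h⟩ := ih
    refine ⟨k + 1, by omega, ?_⟩
    rw [Function.iterate_succ_apply]
    exact (congrArg _ hs).trans h

theorem sz_word_le (w : List Sym) : sz w ≤ 12 * w.length + 1 := by
  induction w with
  | nil => simp
  | cons s w ih =>
    have : sz s ≤ 11 := by rcases s with (_ | _) | _ | _ | _ | _ <;> decide
    simp only [sz_cons, List.length_cons]; omega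

theorem PT.inP {f : List Sym → Bool} (hf : PT tm f) {L : Language Sym}
    (hL : ∀ w, f w = true ↔ w ∈ L) : InP L := by
  -- Reading the input reverses it; the composition with `reverse` undoes this.
  obtain ⟨-, F, t, ⟨p, hp⟩, hF⟩ := hf.comp (PT.reverse (tm := tm) (PT.id (α := List Sym)))
  refine ⟨f, hL, ⟨?_⟩⟩
  let G : Frag tm := (Frag.push false).seq (Frag.readInput.seq (F.seq Frag.writeOutput))
  -- The summands account for pushing the empty list, reading, the program itself, writing, and the
  -- halting step; `12 * n + 1` bounds the size of a word of length `n`.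
  let T : Polynomial ℕ := 1 + (.X + 1 + (p.comp (.C 12 * .X + 1) + 1)) + 1
  have hG : ∀ w, G.Exec { inp := w } { out := [f w] }
      (1 + (w.length + 1 + (p.eval (12 * w.length + 1) + 1))) := fun w => by
    refine Frag.Exec.seq (S' := { inp := w, main := [false] })
      (Frag.exec_prim fun _ r => ⟨r, by simp [conf]⟩) ((Frag.exec_readInput w []).seq
        (Frag.Exec.seq ?_ (Frag.exec_writeOutput (f w))))
    have := (hF w.reverse []).mono ((hp _).trans (eval_mono p (n := 12 * w.length + 1)
      (by simpa using sz_word_le w.reverse)))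
    simpa using this
  have e1 : ∀ w : List Sym, initList G.toFinTM2 w = conf (some G.start) none { inp := w } := by
    intro w
    simp only [initList, conf, Frag.toFinTM2]
    congr 1
    funext k
    rcases k with (_ | _ | _ | _ | _ | _) | k <;> simp <;> rfl
  have e2 : ∀ w : List Bool, haltList G.toFinTM2 w =
      ⟨none, (none, tm.initialState), Store.get { out := w }⟩ := by
    intro w
    simp only [haltList, Frag.toFinTM2]
    congr 1
    funext k
    rcases k with (_ | _ | _ | _ | _ | _) | k <;> simp <;> rfl
  have hrun : ∀ w : List Sym, ∃ k ≤ T.eval w.length, (flip bind G.toFinTM2.step)^[k]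
      (some (initList G.toFinTM2 w)) = some (haltList G.toFinTM2 [f w]) := fun w => by
    obtain ⟨r', h⟩ := hG w _ G.toFinTM2.m some none (fun _ => rfl) none
    have h' := h.trans (.single (c' := ⟨none, (none, tm.initialState),
      Store.get { out := [f w] }⟩) rfl)
    obtain ⟨k, hk, h'⟩ := h'.evalsTo
    refine ⟨k, hk.trans (by simp [T]), ?_⟩
    exact (congrArg (fun c => (flip bind G.toFinTM2.step)^[k] (some c)) (e1 w)).trans
      (h'.trans (congrArg some (e2 [f w])).symm)
  exact
    { tm := G.toFinTM2
      inputAlphabet := Equiv.refl Sym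
      outputAlphabet := Equiv.refl Bool
      time := T
      outputsFun := fun w =>
        { steps := (hrun w).choose
          evals_in_steps := (congrArg (fun v => (flip bind G.toFinTM2.step)^[(hrun w).choose]
            (some (initList G.toFinTM2 v))) (List.map_id w)).trans (hrun w).choose_spec.2
          steps_le_m := (hrun w).choose_spec.1 } }

end Wrapper

/-- A language in P is decided by a program with a suitable subroutine. -/
theorem InP.exists_PT {L : Language Sym} (h : InP L) :
    ∃ (tm : FinTM2) (f : List Sym → Bool), (∀ w, f w = true ↔ w ∈ L) ∧ PT tm f := by
  obtain ⟨f, hf, ⟨M⟩⟩ := h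
  refine ⟨M.tm, f, hf, ?_⟩
  -- Loading a word into the subroutine reverses it, so the reversed function is the one computed
  -- directly.
  suffices h : PT M.tm fun w : List Sym => f w.reverse by
    simpa using h.comp (PT.reverse (PT.id (α := List Sym)))
  let tm := M.tm
  refine ⟨(PolyBound.const 5).of_le fun w => (sz_bool _).le,
    (Frag.loadSub M.inputAlphabet.invFun).seq (Frag.call.seq
      (Frag.unloadSub M.outputAlphabet)),
    fun w => (w.length + 1) + (M.time.eval w.length + 1),
    ((PolyBound.size.of_le length_le_sz).add (.const 1)).add
      (((PolyBound.size.of_le length_le_sz).eval M.time).add (.const 1)), fun w l => ?_⟩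
  have e1 : (Function.update (fun _ => []) tm.k₀ ((w.map M.inputAlphabet.invFun).reverse ++ [])) =
      (initList tm ((id w.reverse).map M.inputAlphabet.invFun)).stk := by
    funext k
    simp only [initList]
    by_cases hk : k = tm.k₀
    · subst hk; simp
    · simp [hk]
  have h1 := Frag.exec_loadSub (tm := tm) M.inputAlphabet.invFun w
    (S := onMain tm ((enc w).code ++ l)) (l := l) rfl
  dsimp only at h1
  rw [e1] at h1
  have h2 := Frag.exec_call (M.outputsFun w.reverse) (onMain tm l)
  refine h1.seq (Frag.Exec.seq (h2.mono (by simp)) (Frag.exec_prim fun x r =>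
    ⟨some (.bit (f w.reverse)), ?_⟩))
  have e2 : (haltList tm (List.map M.outputAlphabet.invFun
      (Computability.encodeBool (f w.reverse)))).stk M.tm.k₁ =
        [M.outputAlphabet.symm (f w.reverse)] := by
    simp [haltList, tm, Computability.encodeBool]
  -- Once the one-symbol answer is popped, all stacks of the subroutine are empty, as `onMain`
  -- demands.
  have e3 : Function.update (haltList tm (List.map M.outputAlphabet.invFun
      (Computability.encodeBool (f w.reverse)))).stk M.tm.k₁ [] = fun _ => [] := by
    funext k
    simp only [haltList]
    by_cases hk : k = tm.k₁
    · subst hk; simp [tm]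
    · rw [Function.update_of_ne hk]; simp [hk]
  rw [TM2.stepAux]
  simp only [get_sub]
  rw [e2]
  simp only [List.head?_cons, List.tail_cons, update_sub]
  rw [e3]
  cases f w.reverse <;> simp [topBit, conf, enc_true, enc_false, D.code] <;> rfl

/-! ### Integers -/

/-- The sign and the binary digits of an integer, those of `-1 - z` if `z` is negative. -/
def zrep : ℤ → Bool × List Bool
  | .ofNat n => (false, n.bits)
  | .negSucc n => (true, n.bits)

instance : Enc ℤ := ⟨fun z => enc (zrep z)⟩

/-- `2 * z + b`. -/
def zbit (b : Bool) (z : ℤ) : ℤ := 2 * z + b.toNat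

/-- The number of binary digits of an integer. -/
def zlen (z : ℤ) : ℕ := (zrep z).2.length

theorem bits_eq (n : ℕ) : n.bits = if n = 0 then [] else n.bodd :: (n / 2).bits := by
  split_ifs with h
  · simp [h]
  · conv_lhs => rw [← Nat.bit_bodd_div2 n]
    rw [Nat.bits_append_bit, Nat.div2_val]
    intro h2
    rw [Nat.div2_val] at h2
    have : n = 1 := by omega
    simp [this]

theorem length_bits_le_iff (n k : ℕ) : n.bits.length ≤ k ↔ n < 2 ^ k := by
  rw [← Nat.size_le, Nat.size_eq_bits_len]

/-- As in two's complement, storing the digits of `-1 - z` for negative `z` makes the range a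
half-open interval. -/
theorem zlen_le_iff (z : ℤ) (k : ℕ) : zlen z ≤ k ↔ -2 ^ k ≤ z ∧ z < 2 ^ k := by
  rcases z with n | n
  · have := length_bits_le_iff n k
    simp only [zlen, zrep, this, Int.ofNat_eq_natCast]
    constructor
    · intro h
      have : (n : ℤ) < 2 ^ k := by exact_mod_cast h
      constructor <;> linarith [pow_pos (show (0 : ℤ) < 2 by norm_num) k, Int.natCast_nonneg n]
    · intro h; exact_mod_cast h.2
  · have := length_bits_le_iff n k
    simp only [zlen, zrep, this, Int.negSucc_eq]
    constructor
    · intro h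
      have : (n : ℤ) < 2 ^ k := by exact_mod_cast h
      constructor <;> linarith [pow_pos (show (0 : ℤ) < 2 by norm_num) k, Int.natCast_nonneg n]
    · intro h
      have : (n : ℤ) < 2 ^ k := by linarith [h.1]
      exact_mod_cast this

theorem lt_two_pow_zlen (z : ℤ) : -2 ^ zlen z ≤ z ∧ z < 2 ^ zlen z := (zlen_le_iff z _).1 le_rfl

theorem zlen_add_le (x y : ℤ) : zlen (x + y) ≤ max (zlen x) (zlen y) + 1 := by
  have hx := (zlen_le_iff x _).1 (le_max_left (zlen x) (zlen y))
  have hy := (zlen_le_iff y _).1 (le_max_right (zlen x) (zlen y))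
  rw [zlen_le_iff, pow_succ]
  constructor <;> linarith

theorem sz_bits (l : List Bool) : sz l = 6 * l.length + 1 := by
  induction l with
  | nil => rfl
  | cons b l ih => simp [ih]; omega

theorem sz_int (z : ℤ) : sz z = 6 * zlen z + 7 := by
  have : sz z = sz (zrep z) := rfl
  rw [this, sz_prod, sz_bits, sz_bool, zlen]; omega

theorem sz_int_add_le (x y : ℤ) : sz (x + y) ≤ sz x + sz y := by
  have := zlen_add_le x y
  simp only [sz_int]; omega

theorem sz_zbit_le (b : Bool) (z : ℤ) : sz (zbit b z) ≤ sz z + 6 := by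
  have h1 := lt_two_pow_zlen z
  have h2 : zlen (zbit b z) ≤ zlen z + 1 := by
    rw [zlen_le_iff, pow_succ, zbit]
    cases b <;> simp <;> omega
  simp only [sz_int]; omega

/-- Negative integers get the complemented digit, as `2 * (-1 - n) + b = -1 - (2 * n + (1 - b))`. A
digit equal to the sign is dropped when no other digits follow, being a superfluous zero. -/
theorem zrep_zbit (b : Bool) (z : ℤ) :
    zrep (zbit b z) = ((zrep z).1, if (zrep z).2.isEmpty && (b == (zrep z).1) then []
      else (b ^^ (zrep z).1) :: (zrep z).2) := by
  have hb : ∀ (n : ℕ) (c : Bool), (2 * n + c.toNat).bits =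
      if n.bits.isEmpty && !c then [] else c :: n.bits := fun n c => by
    have e : 2 * n + c.toNat = Nat.bit c n := by cases c <;> simp [Nat.bit]
    rw [e]
    by_cases h : n = 0 → c = true
    · rw [Nat.bits_append_bit _ _ h]
      rw [if_neg]
      rw [bits_eq n]
      by_cases hn : n = 0
      · simp [h hn]
      · simp [hn]
    · push Not at h
      obtain ⟨rfl, h⟩ := h
      simp [show c = false by simpa using h]
  rcases z with n | n
  · have e : zbit b (Int.ofNat n) = Int.ofNat (2 * n + b.toNat) := by
      simp [zbit]
    rw [e]
    simp only [zrep, hb]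
    cases b <;> simp
  · have e : zbit b (Int.negSucc n) = Int.negSucc (2 * n + (!b).toNat) := by
      simp only [zbit, Int.negSucc_eq]
      cases b <;> simp <;> ring
    rw [e]
    simp only [zrep, hb]
    cases b <;> simp

/-- Rounding down commutes with the reflection `z ↦ -1 - z`, so halving drops a digit whatever the
sign. -/
theorem zrep_half (z : ℤ) : zrep (z / 2) = ((zrep z).1, (zrep z).2.tail) := by
  have ht : ∀ n : ℕ, n.bits.tail = (n / 2).bits := fun n => by
    rw [bits_eq n]; split_ifs with h <;> simp [h]
  rcases z with n | n
  · have e : Int.ofNat n / 2 = Int.ofNat (n / 2) := by simp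
    rw [e, zrep, zrep, ht]
  · have e : Int.negSucc n / 2 = Int.negSucc (n / 2) := by
      simp only [Int.negSucc_eq]; omega
    rw [e, zrep, zrep, ht]

theorem emod_two_eq (z : ℤ) :
    decide (z % 2 = 1) = ((zrep z).2.headD false ^^ (zrep z).1) := by
  have hh : ∀ n : ℕ, n.bits.headD false = decide (n % 2 = 1) := fun n => by
    rw [bits_eq n]
    split_ifs with h
    · simp [h]
    · cases h : n.bodd <;> simp_all [Nat.mod_two_of_bodd]
  rcases z with n | n
  · simp only [zrep, hh, Int.ofNat_eq_natCast, Bool.xor_false, decide_eq_decide]; omega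
  · simp only [zrep, hh, Int.negSucc_eq, Bool.xor_true]
    rw [← decide_not, decide_eq_decide]; omega

theorem zrep_sign (z : ℤ) : (zrep z).1 = decide (z < 0) := by
  rcases z with n | n
  · simp [zrep]
  · simp [zrep, Int.negSucc_lt_zero]

theorem zrep_compl (z : ℤ) : zrep (-1 - z) = (!(zrep z).1, (zrep z).2) := by
  rcases z with n | n
  · have : -1 - Int.ofNat n = Int.negSucc n := by simp [Int.negSucc_eq]; ring
    rw [this]; rfl
  · have : -1 - Int.negSucc n = Int.ofNat n := by simp [Int.negSucc_eq]
    rw [this]; rfl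

namespace PT

variable {tm : FinTM2} {α β : Type} [Enc α] [Enc β]

theorem rep {f : α → ℤ} (hf : PT tm f) : PT tm fun a => zrep (f a) :=
  comp (g := zrep) (of_enc_eq fun _ => rfl) hf

theorem of_rep {f : α → ℤ} (hf : PT tm fun a => zrep (f a)) : PT tm f := hf

theorem zbit {f : α → Bool} {g : α → ℤ} (hf : PT tm f) (hg : PT tm g) :
    PT tm fun a => zbit (f a) (g a) := by
  refine of_rep ?_
  have hg := hg.rep
  have hx : PT tm fun a => f a ^^ (zrep (g a)).1 := by
    convert hf.ite hg.prod_fst.not hg.prod_fst using 2 with a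
    cases f a <;> simp
  have he : PT tm fun a => f a == (zrep (g a)).1 := by
    convert hx.not using 2 with a
    cases f a <;> simp
  simp only [zrep_zbit]
  exact hg.prod_fst.pair (((hg.prod_snd.isEmpty).and he).ite (const _) (hx.list_cons hg.prod_snd))

theorem half {f : α → ℤ} (hf : PT tm f) : PT tm fun a => f a / 2 := by
  refine of_rep ?_
  simp only [zrep_half]
  have := hf.rep
  fun_prop

theorem odd {f : α → ℤ} (hf : PT tm f) : PT tm fun a => decide (f a % 2 = 1) := by
  have := hf.rep
  simp only [emod_two_eq]
  have h1 : PT tm fun a => (zrep (f a)).2.headD false := by fun_prop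
  convert h1.ite this.prod_fst.not this.prod_fst using 2 with a
  cases List.headD (zrep (f a)).2 false <;> simp

theorem neg_sign {f : α → ℤ} (hf : PT tm f) : PT tm fun a => decide (f a < 0) := by
  have := hf.rep
  simp only [← zrep_sign]
  fun_prop

theorem compl {f : α → ℤ} (hf : PT tm f) : PT tm fun a => -1 - f a := by
  refine of_rep ?_
  have := hf.rep
  simp only [zrep_compl]
  fun_prop

end PT

/-! ### Integer arithmetic in polynomial time -/

/-- One step of the addition of two integers, with a carry: the least significant digit of the
sum is moved to the list. -/
def addStep (x : ℤ × ℤ × Bool × List Bool) : ℤ × ℤ × Bool × List Bool :=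
  let p := decide (x.1 % 2 = 1)
  let q := decide (x.2.1 % 2 = 1)
  let c := x.2.2.1
  (x.1 / 2, x.2.1 / 2, (p && q) || (p && c) || (q && c), ((p ^^ q) ^^ c) :: x.2.2.2)

/-- The sum of two integers, each one `0` or `-1`, and a carry. -/
def addLast (x : ℤ × ℤ × Bool × List Bool) : ℤ :=
  if x.1 < 0 then if x.2.1 < 0 then if x.2.2.1 then -1 else -2 else if x.2.2.1 then 0 else -1
  else if x.2.1 < 0 then if x.2.2.1 then 0 else -1 else if x.2.2.1 then 1 else 0

/-- The list `l` is only a clock. Each step preserves the value of the remaining summands and carry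
with the collected digits attached below; when the clock runs out, both remainders are `0` or `-1`.
-/
theorem foldl_addStep (l : List Bool) (x : ℤ × ℤ × Bool × List Bool)
    (hx : zlen x.1 ≤ l.length) (hy : zlen x.2.1 ≤ l.length) :
    let y := l.foldl (fun x _ => addStep x) x
    y.2.2.2.foldl (fun z b => zbit b z) (addLast y) =
      x.2.2.2.foldl (fun z b => zbit b z) (x.1 + x.2.1 + x.2.2.1.toNat) := by
  induction l generalizing x with
  | nil =>
    obtain ⟨a, b, c, acc⟩ := x
    rw [List.length_nil, zlen_le_iff] at hx hy
    simp only [pow_zero] at hx hy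
    dsimp only [List.foldl_nil, addLast]
    congr 1
    have ha : a = 0 ∨ a = -1 := by omega
    have hb : b = 0 ∨ b = -1 := by omega
    rcases ha with rfl | rfl <;> rcases hb with rfl | rfl <;> cases c <;> rfl
  | cons d l ih =>
    obtain ⟨a, b, c, acc⟩ := x
    have hlen : ∀ z : ℤ, zlen z ≤ (d :: l).length → zlen (z / 2) ≤ l.length := fun z h => by
      rw [List.length_cons] at h
      rw [zlen_le_iff, pow_succ] at h
      rw [zlen_le_iff]
      omega
    have := ih (addStep (a, b, c, acc)) (hlen _ hx) (hlen _ hy)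
    simp only [List.foldl_cons] at this ⊢
    rw [this]
    simp only [addStep, List.foldl_cons]
    congr 1
    rw [zbit]
    rcases Int.emod_two_eq_zero_or_one a with ha | ha <;>
      rcases Int.emod_two_eq_zero_or_one b with hb | hb <;> cases c <;>
        simp [ha, hb] <;> omega

namespace PT

variable {tm : FinTM2} {α β : Type} [Enc α] [Enc β]

@[fun_prop]
theorem int_add {f g : α → ℤ} (hf : PT tm f) (hg : PT tm g) : PT tm fun a => f a + g a := by
  have hodd : ∀ h : α × (ℤ × ℤ × Bool × List Bool) × Bool → ℤ, PT tm h →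
    PT tm fun a => decide (h a % 2 = 1) := fun h hh => hh.odd
  have hxor : ∀ {γ : Type} [Enc γ] {p q : γ → Bool}, PT tm p → PT tm q →
      PT tm fun a => p a ^^ q a := by
    intro γ _ p q hp hq
    convert hp.ite hq.not hq using 2 with a
    cases p a <;> simp
  have hstep : PT tm fun x : α × (ℤ × ℤ × Bool × List Bool) × Bool => addStep x.2.1 := by
    have h1 : PT tm fun x : α × (ℤ × ℤ × Bool × List Bool) × Bool => decide (x.2.1.1 % 2 = 1) :=
      odd (by fun_prop)
    have h2 : PT tm fun x : α × (ℤ × ℤ × Bool × List Bool) × Bool => decide (x.2.1.2.1 % 2 = 1) :=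
      odd (by fun_prop)
    have h3 : PT tm fun x : α × (ℤ × ℤ × Bool × List Bool) × Bool => x.2.1.2.2.1 := by fun_prop
    exact (half (by fun_prop)).pair ((half (by fun_prop)).pair ((((h1.and h2).or (h1.and h3)).or
      (h2.and h3)).pair ((hxor (hxor h1 h2) h3).list_cons (by fun_prop))))
  -- The two digit lists together are long enough as a clock. A step adds one truth value to the
  -- collected digits, hence growth by at most `6`.
  have h1 : PT tm fun a => ((zrep (f a)).2 ++ (zrep (g a)).2).foldl (fun x _ => addStep x)
      (f a, g a, false, []) := by
    refine foldl_of_growth (step := fun (_ : α) x (_ : Bool) => addStep x)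
      (hf.rep.prod_snd.append hg.rep.prod_snd) (hf.pair (hg.pair (const _))) hstep
      (fun _ => 6) (.const 6) fun a x _ => ?_
    have hh : ∀ z : ℤ, sz (z / 2) ≤ sz z := fun z => by
      simp only [sz_int, zlen, zrep_half, List.length_tail]; omega
    have := hh x.1
    have := hh x.2.1
    simp only [addStep, sz_prod x, sz_prod x.2, sz_prod x.2.2, sz_pair, sz_cons, sz_bool]
    omega
  have h2 : PT tm fun x : ℤ × ℤ × Bool × List Bool => addLast x := by
    have h1 : PT tm fun x : ℤ × ℤ × Bool × List Bool => decide (x.1 < 0) :=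
      neg_sign (by fun_prop)
    have h2 : PT tm fun x : ℤ × ℤ × Bool × List Bool => decide (x.2.1 < 0) :=
      neg_sign (by fun_prop)
    unfold addLast
    fun_prop
  have h3 : PT tm fun x : ℤ × ℤ × Bool × List Bool =>
      x.2.2.2.foldl (fun z b => QV.zbit b z) (addLast x) := by
    refine foldl_of_growth
      (step := fun (_ : ℤ × ℤ × Bool × List Bool) (z : ℤ) (b : Bool) => QV.zbit b z) (by fun_prop) h2
      (PT.zbit (by fun_prop) (by fun_prop)) (fun _ => 6) (.const 6) fun _ z b => sz_zbit_le b z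
  convert h3.comp h1 using 2 with a
  have := foldl_addStep ((zrep (f a)).2 ++ (zrep (g a)).2) (f a, g a, false, [])
    (by simp [zlen]) (by simp [zlen])
  simpa using this.symm

@[fun_prop]
theorem int_neg {f : α → ℤ} (hf : PT tm f) : PT tm fun a => -f a := by
  convert hf.compl.int_add (const 1) using 2 with a
  ring

@[fun_prop]
theorem int_sub {f g : α → ℤ} (hf : PT tm f) (hg : PT tm g) : PT tm fun a => f a - g a := by
  simpa only [sub_eq_add_neg] using hf.int_add hg.int_neg

@[fun_prop]
theorem int_lt {f g : α → ℤ} (hf : PT tm f) (hg : PT tm g) :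
    PT tm fun a => decide (f a < g a) := by
  simpa [sub_neg] using (hf.int_sub hg).neg_sign

@[fun_prop]
theorem int_le {f g : α → ℤ} (hf : PT tm f) (hg : PT tm g) :
    PT tm fun a => decide (f a ≤ g a) := by
  convert (hg.int_lt hf).not using 2 with a
  rw [← _root_.decide_not, decide_eq_decide, not_lt]

@[fun_prop]
theorem int_eq {f g : α → ℤ} (hf : PT tm f) (hg : PT tm g) :
    PT tm fun a => decide (f a = g a) := by
  convert (hf.int_le hg).and (hg.int_le hf) using 2 with a
  rw [← Bool.decide_and, decide_eq_decide, le_antisymm_iff]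

@[fun_prop]
theorem int_mul {f g : α → ℤ} (hf : PT tm f) (hg : PT tm g) : PT tm fun a => f a * g a := by
  have h1 : PT tm fun a => (zrep (f a)).2.foldr
      (fun d z => z + z + (if d then g a else 0)) (0 : ℤ) := by
    have hg' : PT tm fun x : α × Bool × ℤ => g x.1 := hg.comp (by fun_prop)
    refine foldr_of_growth (step := fun a d z => z + z + (if d then g a else 0))
      hf.rep.prod_snd (const 0) (by fun_prop) (fun x => sz (g x.1) + 20)
      ((hg.1.comp PolyBound.fst).add (.const 20)) fun a d z => ?_
    have h1 := zlen_add_le z z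
    have h2 := zlen_add_le (z + z) (if d then g a else 0)
    have h3 : zlen (if d then g a else 0) ≤ zlen (g a) := by
      split
      · rfl
      · simp [zlen, zrep]
    simp only [sz_int]; omega
  have key : ∀ (n : ℕ) (y : ℤ), n.bits.foldr (fun d z => z + z + (if d then y else 0)) (0 : ℤ) =
      n * y := fun n y => by
    induction n using Nat.strong_induction_on with
    | _ n ih =>
      rw [bits_eq]
      split_ifs with h
      · simp [h]
      · rw [List.foldr_cons, ih (n / 2) (by omega)]
        have := Nat.bodd_add_div2 n
        rw [Nat.div2_val] at this
        conv_rhs => rw [← this]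
        cases n.bodd <;> simp <;> ring
  -- Horner's scheme multiplies by the number `n` that the digits represent; a negative factor is
  -- `-(n + 1)`, whence the additional `g a`.
  convert hf.neg_sign.ite ((h1.int_add hg).int_neg) h1 using 2 with a
  rcases h : f a with n | n
  · have := Int.natCast_nonneg n
    simp only [zrep, key, Int.ofNat_eq_natCast, decide_eq_true_eq]
    rw [if_neg (by omega)]
  · have := Int.natCast_nonneg n
    simp only [zrep, key, Int.negSucc_eq, decide_eq_true_eq]
    rw [if_pos (by omega)]
    ring

@[fun_prop]
theorem sum_map {f : α → List β} {g : α → β → ℤ} (hf : PT tm f)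
    (hg : PT tm fun x : α × β => g x.1 x.2) : PT tm fun a => ((f a).map (g a)).sum := by
  have hg' : PT tm fun x : α × β × ℤ => g x.1 x.2.1 := hg.comp (f := fun x : α × β × ℤ =>
    (x.1, x.2.1)) (by fun_prop)
  have := foldr_of_growth (step := fun a b z => g a b + z) hf (const (0 : ℤ)) (by fun_prop)
    (fun x => sz (g x.1 x.2)) hg.1 (fun a b z => by
      have := sz_int_add_le (g a b) z; dsimp only; omega)
  convert this using 2 with a
  induction f a with
  | nil => rfl
  | cons b l ih => simp [ih]

@[fun_prop]
theorem list_length {f : α → List β} (hf : PT tm f) : PT tm fun a => ((f a).length : ℤ) := by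
  have := sum_map (g := fun _ _ => 1) hf (const _)
  simpa using this

end PT

/-! ### The search for a beneficial deviation -/

/-- The list `[s (… (s x)), …, s x, x]` of the same length as `l`. -/
def iterList {β γ : Type} (s : β → β) (x : β) (l : List γ) : List β :=
  l.foldl (fun d _ => (if d.isEmpty then x else s (d.headD x)) :: d) []

/-- The largest integer with a given property, by bisection. -/
def bisect (test : ℤ → Bool) (lo : ℤ) (P : List ℤ) : ℤ :=
  P.foldl (fun K p => if test (K + p) then K + p else K) lo

/-- An outcome: a number, the utility, the number of votes of the other agents, and the number of
votes of the agent. -/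
abbrev Item : Type := ℤ × ℤ × ℤ × ℤ

namespace Item

/-- The number of the outcome. -/
abbrev idx (x : Item) : ℤ := x.1

/-- The utility of the outcome. -/
abbrev util (x : Item) : ℤ := x.2.1

/-- The number of votes of the other agents. -/
abbrev others (x : Item) : ℤ := x.2.2.1

/-- The number of votes of the agent. -/
abbrev own (x : Item) : ℤ := x.2.2.2

end Item

/-- The difference between the costs of making an outcome a winner and a loser, if winners need
`s` votes more than it has from the other agents. -/
def winCost (s : ℤ) : ℤ := if s ≤ 1 then 2 * s - 1 else s * s

/-- The cost of making an outcome a loser. -/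
def loseCost (s : ℤ) : ℤ := if s ≤ 1 then (1 - s) * (1 - s) else 0

/-- With `k` winners, `x` is a better winner than `y`. -/
def beats (cmp : ℤ → ℤ → Bool) (k K : ℤ) (x y : Item) : Bool :=
  cmp (x.util - y.util) (k * (winCost (K - x.others) - winCost (K - y.others)))

/-- The outcome `x` precedes `y` in the order by quality, ties being broken by number. -/
def above (cmp : ℤ → ℤ → Bool) (k K : ℤ) (x y : Item) : Bool :=
  beats cmp k K x y || (!(beats cmp k K y x) && decide (x.idx < y.idx))

/-- The threshold at which the order of `x` and `y` changes. -/
def thresh (cmp : ℤ → ℤ → Bool) (k lo : ℤ) (P : List ℤ) (x y : Item) : ℤ :=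
  bisect (fun K => if x.others ≤ y.others then beats cmp k K x y else !(beats cmp k K x y)) lo P

/-- The winning thresholds to be tried. -/
def thresholds (cmp : ℤ → ℤ → Bool) (k lo : ℤ) (P : List ℤ) (L : List Item) : List ℤ :=
  (lo + 1) :: L.flatMap fun x => L.map fun y => thresh cmp k lo P x y + 1

/-- The outcomes at least as good as `w`. -/
def chosen (cmp : ℤ → ℤ → Bool) (k K : ℤ) (L : List Item) (w : Item) : List Item :=
  L.filter fun x => !(above cmp k K w x)

/-- The price of the cheapest ballot that makes precisely the outcomes in `W` win with `K`
votes. -/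
def ballotCost (L W : List Item) (K : ℤ) : ℤ :=
  (L.map fun x => loseCost (K - x.others)).sum + (W.map fun x => winCost (K - x.others)).sum

/-- The best number of votes of the winners, if precisely the outcomes in `W` win. -/
def bestLevel (lo : ℤ) (P : List ℤ) (L W : List Item) : ℤ :=
  bisect (fun K => decide (ballotCost L W K < ballotCost L W (K - 1))) lo P

/-- The current winners. -/
def current (L : List Item) : List Item :=
  L.filter fun x => L.all fun y => decide (y.others + y.own ≤ x.others + x.own)

/-- Winners `W` with `K` votes are better than the current winners. -/
def accept (cmp : ℤ → ℤ → Bool) (L W : List Item) (K : ℤ) : Bool :=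
  cmp ((W.map fun x => x.util).sum * (current L).length -
      ((current L).map fun x => x.util).sum * W.length)
    (W.length * (current L).length * (ballotCost L W K - (L.map fun x => x.own * x.own).sum))

/-- A strict bound for all relevant numbers of votes. -/
def levelBound (L : List Item) : ℤ := (L.map fun x => x.others * x.others).sum + 2

/-- The powers of two used in a bisection of `[-B, B]`. -/
def stepList (B : ℤ) : List ℤ := iterList (fun x => x + x) 1 (zrep (B + B)).2

/-- There is a beneficial deviation. -/
def improves (cmp : ℤ → ℤ → Bool) (L : List Item) : Bool :=
  L.any fun z =>
    (thresholds cmp (z.idx + 1) (-levelBound L) (stepList (levelBound L)) L).any fun K =>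
      L.any fun w => accept cmp L (chosen cmp (z.idx + 1) K L w)
        (bestLevel (-levelBound L) (stepList (levelBound L)) L (chosen cmp (z.idx + 1) K L w))

theorem foldl_iterList_aux {β γ : Type} (s : β → β) (x : β) (l : List γ) (n : ℕ) :
    l.foldl (fun d _ => (if d.isEmpty then x else s (d.headD x)) :: d)
      ((List.range n).map fun j => s^[j] x).reverse =
    ((List.range (n + l.length)).map fun j => s^[j] x).reverse := by
  induction l generalizing n with
  | nil => rfl
  | cons b l ih =>
    have : (if ((List.range n).map fun j => s^[j] x).reverse.isEmpty then x
        else s (((List.range n).map fun j => s^[j] x).reverse.headD x)) ::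
        ((List.range n).map fun j => s^[j] x).reverse =
        ((List.range (n + 1)).map fun j => s^[j] x).reverse := by
      cases n with
      | zero => rfl
      | succ n => simp [List.range_succ, Function.iterate_succ_apply' s]
    rw [List.foldl_cons, this, ih, List.length_cons, Nat.add_assoc, Nat.add_comm 1]

theorem iterList_eq {β γ : Type} (s : β → β) (x : β) (l : List γ) :
    iterList s x l = ((List.range l.length).map fun j => s^[j] x).reverse := by
  have h := foldl_iterList_aux s x l 0
  rwa [Nat.zero_add] at h

/-! ### The search runs in polynomial time -/

namespace PT

variable {tm : FinTM2} {α β γ : Type} [Enc α] [Enc β] [Enc γ]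

/-- Every step adds a cell about as large as the head of the state, so `foldl_of_growth` does not
apply. Instead the `j`-th iterate has size at most `sz x + j * c`, which bounds the whole list
quadratically. -/
theorem iterList {f : α → List γ} {s : β → β} (x : β) (c : ℕ) (hf : PT tm f) (hs : PT tm s)
    (hc : ∀ y, sz (s y) ≤ sz y + c) : PT tm fun a => iterList s x (f a) := by
  have hx : ∀ j, sz (s^[j] x) ≤ sz x + j * c := fun j => by
    induction j with
    | zero => simp
    | succ j ih =>
      rw [Function.iterate_succ_apply']
      have := hc (s^[j] x)
      rw [Nat.add_mul]; omega
  have hl : ∀ n, sz ((List.range n).map fun j => s^[j] x).reverse ≤ n * (sz x + n * c + 1) + 1 := by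
    intro n
    induction n with
    | zero => simp
    | succ n ih =>
      have h1 := hx n
      have h2 : n * (sz x + n * c + 1) ≤ n * (sz x + (n + 1) * c + 1) := by gcongr; omega
      have h3 : n * c ≤ (n + 1) * c := by gcongr; omega
      simp only [List.range_succ, List.map_append, List.map_cons, List.map_nil,
        List.reverse_append, List.reverse_cons, List.reverse_nil, List.nil_append,
        List.cons_append, sz_cons]
      rw [Nat.add_mul n 1]; omega
  refine foldl (step := fun y : α × List β × γ =>
    (if y.2.1.isEmpty then x else s (y.2.1.headD x)) :: y.2.1) hf (const []) (by fun_prop)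
    ⟨fun a => sz (f a) * (sz x + sz (f a) * c + 1) + 1,
      (hf.1.mul (((PolyBound.const (sz x)).add (hf.1.mul (.const c))).add (.const 1))).add
        (.const 1), fun a l₁ l₂ hl' => ?_⟩
  have h1 := foldl_iterList_aux s x l₁ 0
  simp only [List.range_zero, List.map_nil, List.reverse_nil, Nat.zero_add] at h1
  have h2 : l₁.length ≤ sz (f a) := by
    refine le_trans ?_ (length_le_sz (f a)); rw [hl']; simp
  dsimp only
  rw [h1]
  exact (hl _).trans (by gcongr)

@[fun_prop]
theorem bisect {test : α → ℤ → Bool} {lo : α → ℤ} {P : α → List ℤ}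
    (ht : PT tm fun x : α × ℤ => test x.1 x.2) (hlo : PT tm lo) (hP : PT tm P) :
    PT tm fun a => bisect (test a) (lo a) (P a) := by
  have ht' : PT tm fun x : α × ℤ × ℤ => test x.1 (x.2.1 + x.2.2) :=
    ht.comp (f := fun x : α × ℤ × ℤ => (x.1, x.2.1 + x.2.2)) (by fun_prop)
  refine foldl_of_growth (step := fun a K p => if test a (K + p) then K + p else K) hP hlo
    (by fun_prop) (fun x => sz x.2) PolyBound.snd fun a K p => ?_
  split
  · exact sz_int_add_le K p
  · exact Nat.le_add_right _ _

@[fun_prop]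
theorem winCost {f : α → ℤ} (hf : PT tm f) : PT tm fun a => winCost (f a) := by
  unfold QV.winCost
  fun_prop

@[fun_prop]
theorem loseCost {f : α → ℤ} (hf : PT tm f) : PT tm fun a => loseCost (f a) := by
  unfold QV.loseCost
  fun_prop

@[fun_prop]
theorem stepList {f : α → ℤ} (hf : PT tm f) : PT tm fun a => stepList (f a) :=
  iterList 1 6 (hf.int_add hf).rep.prod_snd (by fun_prop) fun y => by
    have := zlen_add_le y y
    simp only [sz_int]; omega

@[fun_prop]
theorem ballotCost {L W : α → List Item} {K : α → ℤ} (hL : PT tm L) (hW : PT tm W)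
    (hK : PT tm K) : PT tm fun a => ballotCost (L a) (W a) (K a) := by
  unfold QV.ballotCost
  fun_prop

@[fun_prop]
theorem bestLevel {lo : α → ℤ} {P : α → List ℤ} {L W : α → List Item} (hlo : PT tm lo)
    (hP : PT tm P) (hL : PT tm L) (hW : PT tm W) :
    PT tm fun a => bestLevel (lo a) (P a) (L a) (W a) := by
  unfold QV.bestLevel
  fun_prop

@[fun_prop]
theorem current {L : α → List Item} (hL : PT tm L) : PT tm fun a => current (L a) := by
  unfold QV.current
  fun_prop

@[fun_prop]
theorem levelBound {L : α → List Item} (hL : PT tm L) : PT tm fun a => levelBound (L a) := by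
  unfold QV.levelBound
  fun_prop

section cmp

variable {cmp : ℤ → ℤ → Bool}

@[fun_prop]
theorem beats (hcmp : PT tm fun x : ℤ × ℤ => cmp x.1 x.2) {k K : α → ℤ} {x y : α → Item}
    (hk : PT tm k) (hK : PT tm K) (hx : PT tm x) (hy : PT tm y) :
    PT tm fun a => beats cmp (k a) (K a) (x a) (y a) :=
  hcmp.comp (f := fun a => ((x a).util - (y a).util,
    k a * (QV.winCost (K a - (x a).others) - QV.winCost (K a - (y a).others)))) (by fun_prop)

@[fun_prop]
theorem above (hcmp : PT tm fun x : ℤ × ℤ => cmp x.1 x.2) {k K : α → ℤ} {x y : α → Item}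
    (hk : PT tm k) (hK : PT tm K) (hx : PT tm x) (hy : PT tm y) :
    PT tm fun a => above cmp (k a) (K a) (x a) (y a) := by
  unfold QV.above
  fun_prop

@[fun_prop]
theorem thresh (hcmp : PT tm fun x : ℤ × ℤ => cmp x.1 x.2) {k lo : α → ℤ} {P : α → List ℤ}
    {x y : α → Item} (hk : PT tm k) (hlo : PT tm lo) (hP : PT tm P) (hx : PT tm x) (hy : PT tm y) :
    PT tm fun a => thresh cmp (k a) (lo a) (P a) (x a) (y a) := by
  unfold QV.thresh
  fun_prop

@[fun_prop]
theorem thresholds (hcmp : PT tm fun x : ℤ × ℤ => cmp x.1 x.2) {k lo : α → ℤ} {P : α → List ℤ}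
    {L : α → List Item} (hk : PT tm k) (hlo : PT tm lo) (hP : PT tm P) (hL : PT tm L) :
    PT tm fun a => thresholds cmp (k a) (lo a) (P a) (L a) := by
  unfold QV.thresholds
  fun_prop

@[fun_prop]
theorem chosen (hcmp : PT tm fun x : ℤ × ℤ => cmp x.1 x.2) {k K : α → ℤ} {L : α → List Item}
    {w : α → Item} (hk : PT tm k) (hK : PT tm K) (hL : PT tm L) (hw : PT tm w) :
    PT tm fun a => chosen cmp (k a) (K a) (L a) (w a) := by
  unfold QV.chosen
  fun_prop

@[fun_prop]
theorem accept (hcmp : PT tm fun x : ℤ × ℤ => cmp x.1 x.2) {L W : α → List Item} {K : α → ℤ}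
    (hL : PT tm L) (hW : PT tm W) (hK : PT tm K) :
    PT tm fun a => accept cmp (L a) (W a) (K a) :=
  hcmp.comp (f := fun a =>
    (((W a).map fun x => x.util).sum * (QV.current (L a)).length -
      ((QV.current (L a)).map fun x => x.util).sum * (W a).length,
    (W a).length * (QV.current (L a)).length *
      (QV.ballotCost (L a) (W a) (K a) - ((L a).map fun x => x.own * x.own).sum))) (by fun_prop)

@[fun_prop]
theorem improves (hcmp : PT tm fun x : ℤ × ℤ => cmp x.1 x.2) {L : α → List Item} (hL : PT tm L) :
    PT tm fun a => improves cmp (L a) := by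
  unfold QV.improves
  fun_prop

end cmp

end PT

/-! ### Reading an instance -/

/-- Prepend a symbol to the first word of a list of words. -/
def consFirst (s : Sym) (l : List (List Sym)) : List (List Sym) :=
  if l.isEmpty then [] else (s :: l.headD []) :: l.tail

/-- Split a word into words that are terminated by `x`. -/
def splitAtSym (x : Sym) (w : List Sym) : List (List Sym) :=
  w.foldr (fun s d => if s = x then [] :: d else consFirst s d) []

/-- One step of the evaluation of the code of an integer. -/
def evalStep (s : Sym) (z : ℤ) : ℤ :=
  match s with
  | .bit b => zbit b z
  | .minus => -z
  | _ => z

/-- The integer with a given code. -/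
def parseInt (w : List Sym) : ℤ := w.foldr evalStep 0

/-- The matrix with a given code. -/
def parseRows (w : List Sym) : List (List ℤ) :=
  (splitAtSym .semicolon w).map fun r => (splitAtSym .comma r).map parseInt

/-- The entry of a list at a position given by an integer. -/
def entry {β : Type} (d : β) (l : List β) (i : ℤ) : β :=
  (l.foldl (fun x b => (x.1 - 1, if x.1 = 0 then b else x.2)) (i, d)).2

/-- The items of an instance, given by two matrices and the number of a row. -/
def items (U V : List (List ℤ)) (i : ℤ) : List Item :=
  (iterList (fun x => x + 1) (0 : ℤ) (entry [] U i)).map fun o =>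
    (o, entry 0 (entry [] U i) o, (V.map fun r => entry 0 r o).sum - entry 0 (entry [] V i) o,
      entry 0 (entry [] V i) o)

/-- The code of two matrices and a number. -/
def recode (U V : List (List ℤ)) (i : ℤ) : List Sym :=
  rowsCode U ++ Sym.bar :: (rowsCode V ++ Sym.bar :: ((zrep i).2.map Sym.bit))

/-- Two matrices and a number that form an instance. -/
def wellFormed (U V : List (List ℤ)) (i : ℤ) : Bool :=
  decide (0 ≤ i) && decide (i < U.length) && decide ((U.length : ℤ) = V.length) &&
    U.all (fun r => decide ((r.length : ℤ) = (entry [] U i).length)) &&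
      V.all (fun r => decide ((r.length : ℤ) = (entry [] U i).length))

/-- The first matrix of an instance. -/
def parseU (w : List Sym) : List (List ℤ) :=
  parseRows ((splitAtSym .bar (w ++ [.bar])).headD [])

/-- The second matrix of an instance. -/
def parseV (w : List Sym) : List (List ℤ) :=
  parseRows ((splitAtSym .bar (w ++ [.bar])).tail.headD [])

/-- The agent of an instance. -/
def parseI (w : List Sym) : ℤ :=
  parseInt ((splitAtSym .bar (w ++ [.bar])).tail.tail.headD [])

/-- The decision procedure. -/
def decideWord (cmp : ℤ → ℤ → Bool) (w : List Sym) : Bool :=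
  decide (recode (parseU w) (parseV w) (parseI w) = w) &&
    wellFormed (parseU w) (parseV w) (parseI w) &&
      improves cmp (items (parseU w) (parseV w) (parseI w))

/-! ### Parsing and validation run in polynomial time -/

namespace PT

variable {tm : FinTM2} {α β : Type} [Enc α] [Enc β]

@[fun_prop]
theorem decide_sym_eq_sym {f g : α → Sym} (hf : PT tm f) (hg : PT tm g) :
    PT tm fun a => decide (f a = g a) :=
  sym_cases (g := fun a s => decide (f a = s)) hg fun s => decide_sym_eq hf s

@[fun_prop]
theorem consFirst {f : α → Sym} {g : α → List (List Sym)} (hf : PT tm f) (hg : PT tm g) :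
    PT tm fun a => consFirst (f a) (g a) := by
  unfold QV.consFirst
  fun_prop

@[fun_prop]
theorem splitAtSym (x : Sym) {f : α → List Sym} (hf : PT tm f) :
    PT tm fun a => splitAtSym x (f a) := by
  refine foldr_of_growth (step := fun _ s d => if s = x then [] :: d else QV.consFirst s d) hf
    (const []) (by fun_prop) (fun x => sz x.2 + 2) (PolyBound.snd.add (.const 2)) fun a s d => ?_
  have := sz_pos s
  split
  · simp only [sz_cons, sz_nil]; omega
  · cases d with
    | nil => simp [QV.consFirst]
    | cons p d => simp [QV.consFirst]; omega

theorem sz_neg_le (z : ℤ) : sz (-z) ≤ sz z + 6 := by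
  have h1 := lt_two_pow_zlen z
  have h2 : zlen (-z) ≤ zlen z + 1 := by
    rw [zlen_le_iff, pow_succ]
    omega
  simp only [sz_int]; omega

@[fun_prop]
theorem parseInt {f : α → List Sym} (hf : PT tm f) : PT tm fun a => parseInt (f a) := by
  refine foldr_of_growth (step := fun _ s z => evalStep s z) hf (const 0)
    (sym_cases (α := α × Sym × ℤ) (f := fun x => x.2.1) (g := fun x s => evalStep s x.2.2)
      (by fun_prop) fun s => ?_)
    (fun _ => 6) (.const 6) fun a s z => ?_
  · cases s with
    | bit b => exact zbit (const b) (by fun_prop)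
    | minus => exact int_neg (by fun_prop)
    | _ => simp only [evalStep]; fun_prop
  · cases s with
    | bit b => exact sz_zbit_le b z
    | minus => exact sz_neg_le z
    | _ => simp [evalStep]

@[fun_prop]
theorem parseRows {f : α → List Sym} (hf : PT tm f) : PT tm fun a => parseRows (f a) := by
  unfold QV.parseRows
  fun_prop

@[fun_prop]
theorem entry {d : β} {f : α → List β} {i : α → ℤ} (hf : PT tm f) (hi : PT tm i) :
    PT tm fun a => entry d (f a) (i a) := by
  refine prod_snd (foldl_of_growth (δ := ℤ × β)
    (step := fun _ x b => (x.1 - 1, if x.1 = 0 then b else x.2)) hf (hi.pair (const d))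
    (by fun_prop) (fun x => sz x.2 + 20) (PolyBound.snd.add (.const 20)) fun a x b => ?_)
  have h1 := zlen_add_le x.1 (-1)
  have h2 : zlen (-1) = 0 := rfl
  rw [sz_prod x, sz_pair, sz_int, sz_int, sub_eq_add_neg]
  dsimp only
  split <;> omega

@[fun_prop]
theorem items {U V : α → List (List ℤ)} {i : α → ℤ} (hU : PT tm U) (hV : PT tm V) (hi : PT tm i) :
    PT tm fun a => items (U a) (V a) (i a) := by
  have h : PT tm fun a => QV.iterList (fun x => x + 1) (0 : ℤ) (QV.entry [] (U a) (i a)) :=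
    iterList 0 6 (by fun_prop) (by fun_prop) fun y => by
      have h1 := zlen_add_le y 1
      have h2 : zlen 1 = 1 := by simp [zlen, zrep]
      -- For `0` and `-1` the general bound for sums is one digit too weak, so these are checked
      -- directly.
      by_cases hy : zlen y = 0
      · have := (zlen_le_iff y 0).1 hy.le
        have hy : y = 0 ∨ y = -1 := by omega
        rcases hy with rfl | rfl <;> simp [sz_int, zlen, zrep]
      · simp only [sz_int]; omega
  unfold QV.items
  fun_prop

@[fun_prop]
theorem intCode {f : α → ℤ} (hf : PT tm f) : PT tm fun a => intCode (f a) := by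
  have h : PT tm fun a => if f a < 0 then Sym.minus :: (zrep (-f a)).2.map Sym.bit
      else (zrep (f a)).2.map Sym.bit := by
    have h1 := hf.rep
    have h2 := hf.int_neg.rep
    have h3 : PT tm Sym.bit := by
      have := (PT.id (tm := tm) (α := Bool)).ite (const (Sym.bit true)) (const (Sym.bit false))
      convert this using 2 with b
      cases b <;> rfl
    fun_prop
  convert h using 2 with a
  unfold QV.intCode natCode
  rcases f a with n | n
  · rw [if_neg (by simp), if_neg (by simp)]
    rfl
  · rw [if_pos (Int.negSucc_lt_zero n), if_pos (Int.negSucc_lt_zero n)]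
    rw [Int.neg_negSucc]
    rfl

@[fun_prop]
theorem rowsCode {f : α → List (List ℤ)} (hf : PT tm f) : PT tm fun a => rowsCode (f a) := by
  unfold QV.rowsCode QV.rowCode
  fun_prop

@[fun_prop]
theorem recode {U V : α → List (List ℤ)} {i : α → ℤ} (hU : PT tm U) (hV : PT tm V)
    (hi : PT tm i) : PT tm fun a => recode (U a) (V a) (i a) := by
  have h1 := hi.rep
  have h3 : PT tm Sym.bit := by
    have := (PT.id (tm := tm) (α := Bool)).ite (const (Sym.bit true)) (const (Sym.bit false))
    convert this using 2 with b
    cases b <;> rfl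
  unfold QV.recode
  fun_prop

@[fun_prop]
theorem wellFormed {U V : α → List (List ℤ)} {i : α → ℤ} (hU : PT tm U) (hV : PT tm V)
    (hi : PT tm i) : PT tm fun a => wellFormed (U a) (V a) (i a) := by
  unfold QV.wellFormed
  fun_prop

-- The second word is consumed along the first while a flag records agreement; equality also
-- requires that nothing is left over.
@[fun_prop]
theorem decide_word_eq {f g : α → List Sym} (hf : PT tm f) (hg : PT tm g) :
    PT tm fun a => decide (f a = g a) := by
  have h : PT tm fun a => (f a).foldl (fun (x : List Sym × Bool) s =>
      (x.1.tail, x.2 && !x.1.isEmpty && decide (x.1.headD .bar = s))) (g a, true) := by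
    refine foldl_of_growth (step := fun _ (x : List Sym × Bool) s =>
      (x.1.tail, x.2 && !x.1.isEmpty && decide (x.1.headD .bar = s))) hf (hg.pair (const true))
      (by fun_prop) (fun _ => 0) (.const 0) fun a x s => ?_
    rcases x with ⟨_ | ⟨y, l⟩, b⟩ <;> simp
    omega
  have key : ∀ (l l' : List Sym) (b : Bool),
      (let x := l.foldl (fun (x : List Sym × Bool) s =>
        (x.1.tail, x.2 && !x.1.isEmpty && decide (x.1.headD .bar = s))) (l', b)
      (x.2 && x.1.isEmpty)) = (b && decide (l = l')) := by
    intro l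
    induction l with
    | nil => intro l' b; cases l' <;> simp
    | cons s l ih =>
      intro l' b
      cases l' with
      | nil => simpa using ih [] (b && false)
      | cons s' l' =>
        refine (ih l' _).trans ?_
        simp [eq_comm (a := s'), Bool.and_assoc]
  convert h.prod_snd.and h.prod_fst.isEmpty using 2 with a
  simpa using (key (f a) (g a) true).symm

theorem decideWord {cmp : ℤ → ℤ → Bool} (hcmp : PT tm fun x : ℤ × ℤ => cmp x.1 x.2) :
    PT tm fun w => decideWord cmp w := by
  unfold QV.decideWord parseU parseV parseI
  fun_prop

end PT

/-! ### Correctness of the reading -/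

theorem foldr_consFirst {x : Sym} (p w : List Sym) (d : List (List Sym)) (hp : x ∉ w) :
    w.foldr (fun s d => if s = x then [] :: d else consFirst s d) (p :: d) = (w ++ p) :: d := by
  induction w with
  | nil => rfl
  | cons s w ih =>
    simp only [List.mem_cons, not_or] at hp
    rw [List.foldr_cons, ih hp.2]
    simp [Ne.symm hp.1, consFirst]

theorem splitAtSym_flatMap {β : Type} (x : Sym) (f : β → List Sym) (hf : ∀ b, x ∉ f b)
    (l : List β) : splitAtSym x (l.flatMap fun b => f b ++ [x]) = l.map f := by
  unfold splitAtSym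
  induction l with
  | nil => rfl
  | cons b l ih =>
    rw [List.flatMap_cons, List.foldr_append, ih, List.foldr_append]
    simp only [List.foldr_cons, List.foldr_nil, if_true]
    rw [foldr_consFirst _ _ _ (hf b)]
    simp

theorem parseInt_natCode (n : ℕ) : parseInt (natCode n) = n := by
  unfold parseInt natCode
  induction n using Nat.strong_induction_on with
  | _ n ih =>
    rw [bits_eq]
    split_ifs with h
    · simp [h]
    · rw [List.map_cons, List.foldr_cons, ih (n / 2) (by omega)]
      have := Nat.bodd_add_div2 n
      rw [Nat.div2_val] at this
      conv_rhs => rw [← this]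
      simp only [evalStep, zbit]
      push_cast
      ring

theorem parseInt_intCode (z : ℤ) : parseInt (intCode z) = z := by
  unfold intCode
  split_ifs with h
  · have := parseInt_natCode z.natAbs
    unfold parseInt at this ⊢
    rw [List.foldr_cons, this]
    simp only [evalStep]
    omega
  · rw [parseInt_natCode]; omega

theorem parseRows_rowsCode (R : List (List ℤ)) : parseRows (rowsCode R) = R := by
  unfold parseRows rowsCode
  rw [splitAtSym_flatMap _ _ fun r h => (mem_rowCode h).1 rfl, List.map_map]
  conv_rhs => rw [← List.map_id R]
  refine List.map_congr_left fun r _ => ?_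
  simp only [Function.comp, rowCode, id]
  rw [splitAtSym_flatMap _ _ fun r h => (mem_intCode h).1 rfl, List.map_map]
  conv_rhs => rw [← List.map_id r]
  exact List.map_congr_left fun z _ => parseInt_intCode z

theorem natCode_eq_intCode (n : ℕ) : natCode n = intCode n := by
  simp [intCode]

/-- Splitting discards what follows the last separator; the extra bar keeps the agent's number from
being lost. -/
theorem split_code (I : Instance) :
    splitAtSym .bar (I.code ++ [.bar]) = [rowsCode (rows I.u), rowsCode (rows I.v), natCode I.i] := by
  have hx : ∀ z : ℤ, Sym.bar ∉ intCode z := fun z h => (mem_intCode h).2.2 rfl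
  have key : ∀ a b c : List Sym, Sym.bar ∉ a → Sym.bar ∉ b → Sym.bar ∉ c →
      splitAtSym .bar ((a ++ .bar :: (b ++ .bar :: c)) ++ [.bar]) = [a, b, c] := by
    intro a b c ha hb hc
    have h := fun d : List (List Sym) => foldr_consFirst (x := .bar) [] a d ha
    have h' := fun d : List (List Sym) => foldr_consFirst (x := .bar) [] b d hb
    have h'' := fun d : List (List Sym) => foldr_consFirst (x := .bar) [] c d hc
    simp [splitAtSym, h, h', h'']
  exact key _ _ _ (bar_notMem_rowsCode _) (bar_notMem_rowsCode _)
    (by rw [natCode_eq_intCode]; exact hx _)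

theorem parseU_code (I : Instance) : parseU I.code = rows I.u := by
  rw [parseU, split_code, List.headD_cons, parseRows_rowsCode]

theorem parseV_code (I : Instance) : parseV I.code = rows I.v := by
  rw [parseV, split_code, List.tail_cons, List.headD_cons, parseRows_rowsCode]

theorem parseI_code (I : Instance) : parseI I.code = (I.i : ℕ) := by
  rw [parseI, split_code, List.tail_cons, List.tail_cons, List.headD_cons, parseInt_natCode]

theorem entry_eq {β : Type} (d : β) (l : List β) (n : ℕ) : entry d l n = l.getD n d := by
  -- Once the position has been passed the counter stays negative, so the recorded entry is final.
  have neg : ∀ (l : List β) (i : ℤ) (d : β), i < 0 →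
      (l.foldl (fun x b => (x.1 - 1, if x.1 = 0 then b else x.2)) (i, d)).2 = d := by
    intro l
    induction l with
    | nil => intro i d _; rfl
    | cons b l ih =>
      intro i d h
      rw [List.foldl_cons, ih _ _ (by dsimp only; omega)]
      simp only
      rw [if_neg (by omega)]
  unfold entry
  induction l generalizing n with
  | nil => simp
  | cons b l ih =>
    rw [List.foldl_cons]
    cases n with
    | zero => rw [neg _ _ _ (by simp)]; simp
    | succ n =>
      simp only [Nat.cast_add, Nat.cast_one, add_sub_cancel_right, List.getD_cons_succ]
      rw [if_neg (by omega)]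
      exact ih n

theorem entry_rows {n m : ℕ} (A : Fin n → Fin m → ℤ) (i : Fin n) :
    entry [] (rows A) (i : ℕ) = List.ofFn (A i) := by
  rw [entry_eq, rows, List.getD_eq_getElem _ _ (by simp)]
  simp

theorem entry_ofFn {m : ℕ} (f : Fin m → ℤ) (o : Fin m) :
    entry 0 (List.ofFn f) (o : ℕ) = f o := by
  rw [entry_eq, List.getD_eq_getElem _ _ (by simp)]
  simp

theorem wellFormed_rows (I : Instance) : wellFormed (rows I.u) (rows I.v) (I.i : ℕ) = true := by
  unfold wellFormed
  rw [entry_rows]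
  simp [rows, List.mem_ofFn]

theorem recode_rows (I : Instance) : recode (rows I.u) (rows I.v) (I.i : ℕ) = I.code := rfl

/-- Row `i` exists and prescribes the number of columns; as all lengths agree, the defaults of
`getD` do not affect the rebuilt matrices. -/
theorem exists_instance {U V : List (List ℤ)} {i : ℤ} (h : wellFormed U V i = true) :
    ∃ I : Instance, rows I.u = U ∧ rows I.v = V ∧ i = (I.i : ℕ) := by
  simp only [wellFormed, Bool.and_eq_true, decide_eq_true_eq, List.all_eq_true, Nat.cast_inj] at h
  obtain ⟨⟨⟨⟨h0, h1⟩, h2⟩, hU⟩, hV⟩ := h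
  obtain ⟨n, rfl⟩ := Int.eq_ofNat_of_zero_le h0
  have hr : ∀ R : List (List ℤ), R.length = U.length →
      (∀ r ∈ R, r.length = (entry [] U (n : ℤ)).length) →
      rows (fun (j : Fin U.length) (o : Fin (entry [] U (n : ℤ)).length) =>
        (R.getD j []).getD o 0) = R := by
    intro R hR hm
    refine List.ext_getElem (by simp [rows, hR]) fun j h1 h2 => ?_
    simp only [rows, List.getElem_ofFn]
    rw [List.getD_eq_getElem _ _ h2]
    refine List.ext_getElem (by simp [hm R[j] (List.getElem_mem h2)]) fun o h3 h4 => ?_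
    simp only [List.getElem_ofFn]
    rw [List.getD_eq_getElem _ _ h4]
  exact ⟨⟨U.length, (entry [] U (n : ℤ)).length, fun j o => (U.getD j []).getD o 0,
    fun j o => (V.getD j []).getD o 0, ⟨n, by simpa using h1⟩⟩, hr U rfl hU, hr V h2.symm hV, rfl⟩

/-- The item of an outcome. -/
def Instance.item (I : Instance) (o : Fin I.m) : Item :=
  ((o : ℕ), I.u I.i o, totalVotes I.v o - I.v I.i o, I.v I.i o)

theorem items_rows (I : Instance) :
    items (rows I.u) (rows I.v) (I.i : ℕ) = (List.finRange I.m).reverse.map I.item := by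
  have hs : ∀ j : ℕ, (fun x : ℤ => x + 1)^[j] 0 = j := fun j => by
    induction j with
    | zero => rfl
    | succ j ih => rw [Function.iterate_succ_apply', ih]; simp
  unfold items
  rw [entry_rows, entry_rows, iterList_eq]
  simp only [List.length_ofFn, hs]
  have : (List.range I.m) = (List.finRange I.m).map (fun o : Fin I.m => (o : ℕ)) := by
    refine List.ext_getElem (by simp) fun j h1 h2 => by simp
  rw [this, List.map_map, ← List.map_reverse, List.map_map]
  refine List.map_congr_left fun o _ => ?_
  simp only [Function.comp, Instance.item, entry_ofFn]
  congr 4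
  rw [rows, List.ofFn_eq_map, List.map_map, totalVotes, ← List.sum_ofFn, List.ofFn_eq_map]
  congr 1
  exact List.map_congr_left fun j _ => by simp [entry_ofFn]

/-- Comparing the word with the code of what was parsed rejects every word that is not a code, so
the parser needs to be correct on codes only. -/
theorem decideWord_eq_true (cmp : ℤ → ℤ → Bool) (w : List Sym) :
    decideWord cmp w = true ↔ ∃ I : Instance, I.code = w ∧
      improves cmp ((List.finRange I.m).reverse.map I.item) = true := by
  constructor
  · intro h
    simp only [decideWord, Bool.and_eq_true, decide_eq_true_eq] at h
    obtain ⟨⟨h1, h2⟩, h3⟩ := h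
    obtain ⟨I, hU, hV, hi⟩ := exists_instance h2
    refine ⟨I, ?_, ?_⟩
    · rw [← recode_rows, hU, hV, ← hi, h1]
    · rwa [← items_rows, hU, hV, ← hi]
  · rintro ⟨I, rfl, h⟩
    rw [decideWord, parseU_code, parseV_code, parseI_code, items_rows, h, wellFormed_rows,
      recode_rows]
    simp

/-! ### Bisection -/

theorem stepList_eq (B : ℤ) :
    stepList B = ((List.range (zlen (B + B))).map fun j => (2 : ℤ) ^ j).reverse := by
  have h : ∀ j : ℕ, (fun x : ℤ => x + x)^[j] 1 = 2 ^ j := fun j => by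
    induction j with
    | zero => rfl
    | succ j ih => rw [Function.iterate_succ_apply', ih]; ring
  rw [stepList, iterList_eq]
  simp only [h, zlen]

/-- The property is inherited by smaller integers, so one test at `lo + 2 ^ n` decides which half of
the interval contains the last success. The test at `lo` is not needed: `lo` is the answer when all
larger levels fail. -/
theorem bisect_spec {test : ℤ → Bool} (ht : ∀ K K', K ≤ K' → test K' = true → test K = true)
    (n : ℕ) (lo : ℤ) :
    lo ≤ bisect test lo ((List.range n).map fun j => (2 : ℤ) ^ j).reverse ∧
    bisect test lo ((List.range n).map fun j => (2 : ℤ) ^ j).reverse < lo + 2 ^ n ∧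
    ∀ K, lo < K → K < lo + 2 ^ n → (test K = true ↔
      K ≤ bisect test lo ((List.range n).map fun j => (2 : ℤ) ^ j).reverse) := by
  induction n generalizing lo with
  | zero =>
    simp only [bisect, List.range_zero, List.map_nil, List.reverse_nil, List.foldl_nil, pow_zero]
    exact ⟨le_rfl, by omega, fun K h1 h2 => by omega⟩
  | succ n ih =>
    have hp : (0 : ℤ) < 2 ^ n := by positivity
    have e : bisect test lo ((List.range (n + 1)).map fun j => (2 : ℤ) ^ j).reverse =
        bisect test (if test (lo + 2 ^ n) then lo + 2 ^ n else lo)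
          ((List.range n).map fun j => (2 : ℤ) ^ j).reverse := by
      rw [List.range_succ, List.map_append, List.reverse_append]
      rfl
    rw [e, pow_succ]
    split_ifs with h
    · obtain ⟨h1, h2, h3⟩ := ih (lo + 2 ^ n)
      refine ⟨by omega, by omega, fun K hK hK' => ?_⟩
      rcases le_or_gt K (lo + 2 ^ n) with h4 | h4
      · exact iff_of_true (ht _ _ h4 h) (h4.trans h1)
      · exact h3 K h4 (by omega)
    · obtain ⟨h1, h2, h3⟩ := ih lo
      refine ⟨by omega, by omega, fun K hK hK' => ?_⟩
      rcases lt_or_ge K (lo + 2 ^ n) with h4 | h4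
      · exact h3 K hK h4
      · exact iff_of_false (fun h5 => h (ht _ _ h4 h5)) (by omega)

theorem lt_two_pow_steps (B : ℤ) : B < -B + 2 ^ zlen (B + B) := by
  have := (lt_two_pow_zlen (B + B)).2
  omega

/-- A function with increasing differences is minimal where the differences change their sign. -/
theorem le_of_threshold {f : ℤ → ℤ} {lo hi t : ℤ} (h1 : lo ≤ t) (h2 : t < hi)
    (h : ∀ K, lo < K → K < hi → (f K < f (K - 1) ↔ K ≤ t)) {K : ℤ} (hK : lo ≤ K) (hK' : K < hi) :
    f t ≤ f K := by
  rcases le_total K t with hKt | hKt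
  · have key : ∀ s, K ≤ s → s ≤ t → f s ≤ f K := fun s hs => by
      induction s, hs using Int.leInduction with
      | base => intro _; exact le_rfl
      | succ s hs ih =>
        intro hst
        have e2 := (h (s + 1) (by omega) (by omega)).2 hst
        rw [add_sub_cancel_right] at e2
        exact e2.le.trans (ih (by omega))
    exact key _ hKt le_rfl
  · induction K, hKt using Int.leInduction with
    | base => exact le_rfl
    | succ K hs ih =>
      have e2 := (h (K + 1) (by omega) hK').not.2 (by omega)
      rw [add_sub_cancel_right, not_lt] at e2
      exact (ih (by omega) (by omega)).trans e2

/-! ### The cost functions -/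

/-- This is convexity: the slope is `2` up to `s = 1`, where the square takes over with slope at
least `3`. The single change of each comparison of qualities rests on it. -/
theorem winCost_diff_mono {p q e : ℤ} (hpq : p ≤ q) (he : 0 ≤ e) :
    winCost q - winCost p ≤ winCost (q + e) - winCost (p + e) := by
  unfold winCost
  split_ifs <;> nlinarith

theorem loseCost_diff_mono {p q e : ℤ} (hpq : p ≤ q) (he : 0 ≤ e) :
    loseCost q - loseCost p ≤ loseCost (q + e) - loseCost (p + e) := by
  unfold loseCost
  split_ifs <;> nlinarith

/-- If every outcome is first charged as a loser, a winner owes the remaining `winCost`; this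
separates the part of the price that depends on `W`. -/
theorem loseCost_add_winCost (s : ℤ) : loseCost s + winCost s = s * s := by
  unfold loseCost winCost
  split_ifs <;> ring

/-- Among the integers below `s`, the one closest to zero is `min 0 (s - 1)`. -/
theorem loseCost_le {s x : ℤ} (h : x < s) : loseCost s ≤ x * x := by
  unfold loseCost
  split_ifs <;> nlinarith

theorem loseCost_eq (s : ℤ) : loseCost s = min 0 (s - 1) * min 0 (s - 1) := by
  unfold loseCost
  split_ifs with h
  · rw [min_eq_right (by omega)]; ring
  · rw [min_eq_left (by omega)]; ring

/-- Moving the level towards `[t, t + 1]` does not increase the costs. -/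
theorem loseCost_clamp {s s' : ℤ} (h : s ≤ s' ∧ s' ≤ 0 ∨ 1 ≤ s' ∧ s' ≤ s) :
    loseCost s' ≤ loseCost s ∧ s' * s' ≤ s * s := by
  unfold loseCost
  rcases h with h | h
  · rw [if_pos (by omega), if_pos (by omega)]
    constructor <;> nlinarith
  · refine ⟨?_, by nlinarith⟩
    split_ifs <;> nlinarith

section Cost

variable {Ω : Type} [Fintype Ω] [DecidableEq Ω] (t : Ω → ℤ)

/-- The price of the cheapest ballot that makes the outcomes in `W` win with `K` votes. -/
def setCost (W : Finset Ω) (K : ℤ) : ℤ :=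
  ∑ o, loseCost (K - t o) + ∑ o ∈ W, winCost (K - t o)

theorem setCost_eq (W : Finset Ω) (K : ℤ) :
    setCost t W K = ∑ o, if o ∈ W then (K - t o) * (K - t o) else loseCost (K - t o) := by
  rw [setCost, ← Finset.sum_filter_add_sum_filter_not Finset.univ (· ∈ W) (fun o => loseCost _),
    Finset.sum_ite, add_right_comm]
  congr 1
  rw [Finset.filter_mem_eq_inter, Finset.univ_inter, ← Finset.sum_add_distrib]
  exact Finset.sum_congr rfl fun o _ => loseCost_add_winCost _

-- For fixed winners the price is a sum of convex functions of the level, hence convex; this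
-- justifies the bisection for the best level.
omit [DecidableEq Ω] in
theorem setCost_diff_mono (W : Finset Ω) {K K' : ℤ} (h : K ≤ K') :
    setCost t W K - setCost t W (K - 1) ≤ setCost t W K' - setCost t W (K' - 1) := by
  unfold setCost
  have h1 : ∑ o, loseCost (K - t o) - ∑ o, loseCost (K - 1 - t o) ≤
      ∑ o, loseCost (K' - t o) - ∑ o, loseCost (K' - 1 - t o) := by
    rw [← Finset.sum_sub_distrib, ← Finset.sum_sub_distrib]
    refine Finset.sum_le_sum fun o _ => ?_
    have := loseCost_diff_mono (p := K - 1 - t o) (q := K - t o) (e := K' - K) (by omega) (by omega)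
    rwa [show K - t o + (K' - K) = K' - t o by ring,
      show K - 1 - t o + (K' - K) = K' - 1 - t o by ring] at this
  have h2 : ∑ o ∈ W, winCost (K - t o) - ∑ o ∈ W, winCost (K - 1 - t o) ≤
      ∑ o ∈ W, winCost (K' - t o) - ∑ o ∈ W, winCost (K' - 1 - t o) := by
    rw [← Finset.sum_sub_distrib, ← Finset.sum_sub_distrib]
    refine Finset.sum_le_sum fun o _ => ?_
    have := winCost_diff_mono (p := K - 1 - t o) (q := K - t o) (e := K' - K) (by omega) (by omega)
    rwa [show K - t o + (K' - K) = K' - t o by ring,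
      show K - 1 - t o + (K' - K) = K' - 1 - t o by ring] at this
  linarith

/-- Clamping a level to `[1 - B, B - 1]` moves it towards each `[t o, t o + 1]`, which raises no
summand of the price. -/
theorem exists_clamp (W : Finset Ω) (K : ℤ) {B : ℤ} (hB : ∀ o, -B < t o ∧ t o + 1 < B)
    (hB0 : 0 < B) : ∃ K', -B < K' ∧ K' < B ∧ setCost t W K' ≤ setCost t W K := by
  refine ⟨max (1 - B) (min K (B - 1)), by omega, by omega, ?_⟩
  rw [setCost_eq, setCost_eq]
  refine Finset.sum_le_sum fun o _ => ?_
  have := hB o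
  rcases lt_or_ge K (1 - B) with h | h
  · have := loseCost_clamp (s := K - t o) (s' := max (1 - B) (min K (B - 1)) - t o)
      (.inl ⟨by omega, by omega⟩)
    split_ifs
    exacts [this.2, this.1]
  · rcases lt_or_ge (B - 1) K with h' | h'
    · have := loseCost_clamp (s := K - t o) (s' := max (1 - B) (min K (B - 1)) - t o)
        (.inr ⟨by omega, by omega⟩)
      split_ifs
      exacts [this.2, this.1]
    · rw [show max (1 - B) (min K (B - 1)) = K by omega]

end Cost

/-! ### The best winners of a given number -/

section Top

variable {Ω κ : Type} [Fintype Ω] [DecidableEq Ω] [LinearOrder κ]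

theorem exists_initial_segment (key : Ω → κ) (hk : Function.Injective key) (k : ℕ)
    (h : k ≤ Fintype.card Ω) :
    ∃ W : Finset Ω, W.card = k ∧ ∀ x ∈ W, ∀ y ∉ W, key x < key y := by
  induction k with
  | zero => exact ⟨∅, rfl, by simp⟩
  | succ k ih =>
    obtain ⟨W, hW, hlt⟩ := ih (by omega)
    have hne : Wᶜ.Nonempty := by
      rw [← Finset.card_pos, Finset.card_compl]; omega
    obtain ⟨a, ha, hmin⟩ := Finset.exists_min_image Wᶜ key hne
    rw [Finset.mem_compl] at ha
    refine ⟨insert a W, by rw [Finset.card_insert_of_notMem ha, hW], fun x hx y hy => ?_⟩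
    rw [Finset.mem_insert, not_or] at hy
    rcases Finset.mem_insert.1 hx with rfl | hx
    · exact lt_of_le_of_ne (hmin y (Finset.mem_compl.2 hy.2)) fun e => hy.1 (hk e).symm
    · exact hlt x hx y hy.2

/-- Thus the `k` best outcomes are determined by the last of them, and trying every `w` as the last
one is cheap. -/
theorem exists_pivot (key : Ω → κ) (hk : Function.Injective key) (k : ℕ) (hk0 : 0 < k)
    (h : k ≤ Fintype.card Ω) :
    ∃ w, (Finset.univ.filter fun x => key x ≤ key w).card = k := by
  obtain ⟨W, hW, hlt⟩ := exists_initial_segment key hk k h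
  obtain ⟨w, hw, hmax⟩ := Finset.exists_max_image W key (Finset.card_pos.1 (by omega))
  refine ⟨w, ?_⟩
  rw [← hW]
  congr 1
  ext x
  simp only [Finset.mem_filter, Finset.mem_univ, true_and]
  refine ⟨fun hx => ?_, hmax x⟩
  by_contra hxW
  exact absurd (hlt w hw x hxW) (not_lt.2 hx)

-- An exchange argument: `V \ W` and `W \ V` have equally many elements, and `c` separates their
-- values.
omit [Fintype Ω] in
theorem sum_le_sum_of_threshold {W V : Finset Ω} (f : Ω → ℝ) (c : ℝ) (hcard : V.card = W.card)
    (hW : ∀ x ∈ W, c ≤ f x) (hV : ∀ x ∉ W, f x ≤ c) : ∑ x ∈ V, f x ≤ ∑ x ∈ W, f x := by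
  have h1 := Finset.sum_sdiff_sub_sum_sdiff (s₁ := V) (s₂ := W) (f := f)
  have h2 : ∑ x ∈ V \ W, f x ≤ (V \ W).card • c :=
    Finset.sum_le_card_nsmul _ _ _ fun x hx => hV x (Finset.mem_sdiff.1 hx).2
  have h3 : (W \ V).card • c ≤ ∑ x ∈ W \ V, f x :=
    Finset.card_nsmul_le_sum _ _ _ fun x hx => hW x (Finset.mem_sdiff.1 hx).1
  have h4 : (V \ W).card = (W \ V).card := Finset.card_sdiff_comm hcard
  rw [h4] at h2
  linarith

end Top

/-! ### Correctness of the search -/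

section Search

variable {Ω : Type} [Fintype Ω] [DecidableEq Ω]

/-- Winners `W` with `K` votes give more utility than the present winners `W₀`, where the present
ballot costs `C₀`. -/
def Better (α : ℝ) (u t : Ω → ℤ) (W₀ : Finset Ω) (C₀ : ℤ) (W : Finset Ω) (K : ℤ) : Prop :=
  α * ((W.card * W₀.card * (setCost t W K - C₀) : ℤ) : ℝ) <
    (((∑ o ∈ W, u o) * W₀.card - (∑ o ∈ W₀, u o) * W.card : ℤ) : ℝ)

omit [DecidableEq Ω] in
theorem Better.of_cost_le {α : ℝ} (hα : 0 < α) {u t : Ω → ℤ} {W₀ W : Finset Ω} {C₀ K K' : ℤ}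
    (h : Better α u t W₀ C₀ W K) (hK : setCost t W K' ≤ setCost t W K) :
    Better α u t W₀ C₀ W K' := by
  refine lt_of_le_of_lt (mul_le_mul_of_nonneg_left ?_ hα.le) h
  exact_mod_cast mul_le_mul_of_nonneg_left (sub_le_sub_right hK _) (by positivity)

/-- The quality of a winner, if there are `k` winners with `K` votes. -/
def quality (α : ℝ) (u t : Ω → ℤ) (k K : ℤ) (o : Ω) : ℝ := u o - α * (k * winCost (K - t o) : ℤ)

-- The left side depends on `W` only through its cardinality, so among sets of equal size a larger
-- sum of qualities is at least as good.
omit [DecidableEq Ω] in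
theorem better_iff {α : ℝ} {u t : Ω → ℤ} {W₀ W : Finset Ω} {C₀ K : ℤ} :
    Better α u t W₀ C₀ W K ↔
      α * ((W.card * W₀.card * (∑ o, loseCost (K - t o) - C₀) : ℤ) : ℝ) +
        (((∑ o ∈ W₀, u o) * W.card : ℤ) : ℝ) <
      W₀.card * ∑ o ∈ W, quality α u t W.card K o := by
  unfold Better setCost quality
  rw [Finset.sum_sub_distrib, ← Finset.mul_sum]
  push_cast
  rw [← Finset.mul_sum]
  constructor <;> intro h <;> linarith

variable (u t b idx : Ω → ℤ)

/-- The item of an outcome. -/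
def toItem (o : Ω) : Item := (idx o, u o, t o, b o)

variable {l : List Ω}

omit [Fintype Ω] [DecidableEq Ω] in
theorem filter_map_toItem (p : Item → Bool) :
    (l.map (toItem u t b idx)).filter p =
      (l.filter fun o => p (toItem u t b idx o)).map (toItem u t b idx) := by
  rw [List.filter_map]; rfl

theorem sum_filter_eq (hl : l.Nodup) (hm : ∀ o, o ∈ l) (p : Ω → Bool) (f : Item → ℤ) :
    (((l.filter p).map (toItem u t b idx)).map f).sum =
      ∑ o ∈ Finset.univ.filter (fun o => p o = true), f (toItem u t b idx o) := by
  rw [List.map_map, ← List.sum_toFinset _ (hl.filter _)]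
  refine Finset.sum_congr ?_ fun _ _ => rfl
  ext o; simp [hm o]

theorem sum_all_eq (hl : l.Nodup) (hm : ∀ o, o ∈ l) (f : Item → ℤ) :
    ((l.map (toItem u t b idx)).map f).sum = ∑ o, f (toItem u t b idx o) := by
  have := sum_filter_eq u t b idx hl hm (fun _ => true) f
  simpa using this

theorem length_filter_eq (hl : l.Nodup) (hm : ∀ o, o ∈ l) (p : Ω → Bool) :
    ((l.filter p).map (toItem u t b idx)).length =
      (Finset.univ.filter (fun o => p o = true)).card := by
  rw [List.length_map, ← List.toFinset_card_of_nodup (hl.filter _)]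
  congr 1
  ext o; simp [hm o]

theorem ballotCost_eq (hl : l.Nodup) (hm : ∀ o, o ∈ l) (p : Ω → Bool) (K : ℤ) :
    ballotCost (l.map (toItem u t b idx)) ((l.filter p).map (toItem u t b idx)) K =
      setCost t (Finset.univ.filter fun o => p o = true) K := by
  rw [ballotCost, setCost, sum_all_eq u t b idx hl hm, sum_filter_eq u t b idx hl hm]
  rfl

/-- The present winners. -/
def topSet : Finset Ω := Finset.univ.filter fun x => ∀ y, t y + b y ≤ t x + b x

omit [DecidableEq Ω] in
theorem current_eq (hm : ∀ o, o ∈ l) :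
    current (l.map (toItem u t b idx)) =
      (l.filter fun x => decide (∀ y, t y + b y ≤ t x + b x)).map (toItem u t b idx) := by
  rw [current, filter_map_toItem]
  congr 1
  refine List.filter_congr fun x _ => ?_
  rw [Bool.eq_iff_iff]
  simp only [List.all_map, List.all_eq_true, Function.comp_apply, hm, true_imp_iff,
    decide_eq_true_eq]
  exact Iff.rfl

variable {α : ℝ} {cmp : ℤ → ℤ → Bool}

theorem accept_iff (hcmp : ∀ X Y : ℤ, cmp X Y = true ↔ α * Y < X) (hl : l.Nodup)
    (hm : ∀ o, o ∈ l) (p : Ω → Bool) (K : ℤ) :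
    accept cmp (l.map (toItem u t b idx)) ((l.filter p).map (toItem u t b idx)) K = true ↔
      Better α u t (topSet t b) (∑ o, b o * b o) (Finset.univ.filter fun o => p o = true) K := by
  rw [accept, hcmp, Better, current_eq u t b idx hm, ballotCost_eq u t b idx hl hm,
    sum_all_eq u t b idx hl hm, sum_filter_eq u t b idx hl hm, sum_filter_eq u t b idx hl hm,
    length_filter_eq u t b idx hl hm, length_filter_eq u t b idx hl hm]
  simp only [decide_eq_true_eq]
  rfl

omit [Fintype Ω] [DecidableEq Ω] in
theorem beats_iff (hcmp : ∀ X Y : ℤ, cmp X Y = true ↔ α * Y < X) (k K : ℤ) (x y : Ω) :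
    beats cmp k K (toItem u t b idx x) (toItem u t b idx y) = true ↔
      quality α u t k K y < quality α u t k K x := by
  rw [beats, hcmp]
  simp only [toItem, quality]
  push_cast
  constructor <;> intro h <;> linarith

/-- The key that sorts the outcomes by quality. -/
noncomputable def sortKey (α : ℝ) (k K : ℤ) (o : Ω) : ℝ ×ₗ ℤ := toLex (-quality α u t k K o, idx o)

-- Larger quality means a smaller key. The number as second component makes the keys distinct when
-- `idx` is injective, as `exists_pivot` requires.
omit [Fintype Ω] [DecidableEq Ω] in
theorem above_iff (hcmp : ∀ X Y : ℤ, cmp X Y = true ↔ α * Y < X) (k K : ℤ) (x y : Ω) :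
    above cmp k K (toItem u t b idx x) (toItem u t b idx y) = true ↔
      sortKey u t idx α k K x < sortKey u t idx α k K y := by
  rw [above, Bool.or_eq_true, Bool.and_eq_true, Bool.not_eq_true', ← Bool.not_eq_true,
    beats_iff u t b idx hcmp, beats_iff u t b idx hcmp, decide_eq_true_eq, sortKey, sortKey,
    Prod.Lex.toLex_lt_toLex]
  simp only [toItem, neg_lt_neg_iff, neg_inj, not_lt]
  constructor
  · rintro (h | ⟨h1, h2⟩)
    · exact .inl h
    · rcases h1.lt_or_eq with h3 | h3
      · exact .inl h3
      · exact .inr ⟨h3.symm, h2⟩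
  · rintro (h | ⟨h1, h2⟩)
    · exact .inl h
    · exact .inr ⟨h1.ge, h2⟩

omit [Fintype Ω] [DecidableEq Ω] in
theorem chosen_eq (hcmp : ∀ X Y : ℤ, cmp X Y = true ↔ α * Y < X) (k K : ℤ) (w : Ω) :
    chosen cmp k K (l.map (toItem u t b idx)) (toItem u t b idx w) =
      (l.filter fun x => decide (sortKey u t idx α k K x ≤ sortKey u t idx α k K w)).map
        (toItem u t b idx) := by
  rw [chosen, filter_map_toItem]
  congr 1
  refine List.filter_congr fun x _ => ?_
  rw [Bool.eq_iff_iff, Bool.not_eq_true', ← Bool.not_eq_true, above_iff u t b idx hcmp,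
    decide_eq_true_eq, not_lt]

-- By convexity the outcome with fewer votes from the others can only lose ground as `K` grows. So
-- `x` beats `y` on an initial segment of levels if `t x ≤ t y`, and otherwise fails to beat `y` on
-- one; bisection finds its end.
omit [Fintype Ω] [DecidableEq Ω] in
theorem thresh_spec (hα : 0 < α) (hcmp : ∀ X Y : ℤ, cmp X Y = true ↔ α * Y < X) {k : ℤ}
    (hk : 0 ≤ k) (lo B : ℤ) (x y : Ω) :
    lo ≤ thresh cmp k lo (stepList B) (toItem u t b idx x) (toItem u t b idx y) ∧
    ∀ K K', lo < K → K < lo + 2 ^ zlen (B + B) → lo < K' → K' < lo + 2 ^ zlen (B + B) →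
      (K ≤ thresh cmp k lo (stepList B) (toItem u t b idx x) (toItem u t b idx y) ↔
        K' ≤ thresh cmp k lo (stepList B) (toItem u t b idx x) (toItem u t b idx y)) →
      (quality α u t k K y < quality α u t k K x ↔
        quality α u t k K' y < quality α u t k K' x) := by
  have key : ∀ K K' : ℤ, K ≤ K' → ∀ x y, t x ≤ t y →
      quality α u t k K' y < quality α u t k K' x → quality α u t k K y < quality α u t k K x := by
    intro K K' hK x y hxy h
    have h1 := winCost_diff_mono (p := K - t y) (q := K - t x) (e := K' - K) (by omega) (by omega)
    rw [show K - t x + (K' - K) = K' - t x by ring,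
      show K - t y + (K' - K) = K' - t y by ring] at h1
    have h2 : ((k * (winCost (K - t x) - winCost (K - t y)) : ℤ) : ℝ) ≤
        ((k * (winCost (K' - t x) - winCost (K' - t y)) : ℤ) : ℝ) := by
      exact_mod_cast mul_le_mul_of_nonneg_left h1 hk
    have h3 := mul_le_mul_of_nonneg_left h2 hα.le
    unfold quality at h ⊢
    push_cast at h h3 ⊢
    linarith
  have key' : ∀ K K' : ℤ, K ≤ K' → ∀ x y, t y < t x →
      quality α u t k K y < quality α u t k K x →
        quality α u t k K' y < quality α u t k K' x := by
    intro K K' hK x y hxy h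
    have h1 := winCost_diff_mono (p := K - t x) (q := K - t y) (e := K' - K) (by omega) (by omega)
    rw [show K - t x + (K' - K) = K' - t x by ring,
      show K - t y + (K' - K) = K' - t y by ring] at h1
    have h2 : ((k * (winCost (K - t y) - winCost (K - t x)) : ℤ) : ℝ) ≤
        ((k * (winCost (K' - t y) - winCost (K' - t x)) : ℤ) : ℝ) := by
      exact_mod_cast mul_le_mul_of_nonneg_left h1 hk
    have h3 := mul_le_mul_of_nonneg_left h2 hα.le
    unfold quality at h ⊢
    push_cast at h h3 ⊢
    linarith
  have hitem : (toItem u t b idx x).others = t x ∧ (toItem u t b idx y).others = t y := ⟨rfl, rfl⟩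
  rw [thresh, stepList_eq, hitem.1, hitem.2]
  by_cases hxy : t x ≤ t y
  · simp only [hxy, if_true]
    obtain ⟨h1, -, h2⟩ := bisect_spec
      (test := fun K => beats cmp k K (toItem u t b idx x) (toItem u t b idx y))
      (fun K K' hK h => by
        rw [beats_iff u t b idx hcmp] at h ⊢
        exact key K K' hK x y hxy h) (zlen (B + B)) lo
    refine ⟨h1, fun K K' a1 a2 a3 a4 h => ?_⟩
    rw [← beats_iff u t b idx hcmp, ← beats_iff u t b idx hcmp, h2 K a1 a2, h2 K' a3 a4, h]
  · simp only [hxy, if_false]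
    obtain ⟨h1, -, h2⟩ := bisect_spec
      (test := fun K => !beats cmp k K (toItem u t b idx x) (toItem u t b idx y))
      (fun K K' hK h => by
        rw [Bool.not_eq_true', ← Bool.not_eq_true, beats_iff u t b idx hcmp] at h ⊢
        exact fun h' => h (key' K K' hK x y (not_le.1 hxy) h')) (zlen (B + B)) lo
    refine ⟨h1, fun K K' a1 a2 a3 a4 h => ?_⟩
    have e1 := h2 K a1 a2
    have e2 := h2 K' a3 a4
    rw [Bool.not_eq_true', ← Bool.not_eq_true, beats_iff u t b idx hcmp] at e1 e2
    rw [← not_iff_not, e1, e2, h]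

omit [Fintype Ω] [DecidableEq Ω] in
/-- Every relevant level has the same order of outcomes as one of the thresholds. -/
theorem exists_threshold (hα : 0 < α) (hcmp : ∀ X Y : ℤ, cmp X Y = true ↔ α * Y < X) {k : ℤ}
    (hk : 0 ≤ k) (hm : ∀ o, o ∈ l) (lo B : ℤ) {K : ℤ} (h1 : lo < K)
    (h2 : K < lo + 2 ^ zlen (B + B)) :
    ∃ K' ∈ thresholds cmp k lo (stepList B) (l.map (toItem u t b idx)), ∀ x y,
      sortKey u t idx α k K' x ≤ sortKey u t idx α k K' y ↔
        sortKey u t idx α k K x ≤ sortKey u t idx α k K y := by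
  set T := thresholds cmp k lo (stepList B) (l.map (toItem u t b idx)) with hT
  have hmem : ∀ x y,
      thresh cmp k lo (stepList B) (toItem u t b idx x) (toItem u t b idx y) + 1 ∈ T := by
    intro x y
    simp only [hT, thresholds, List.mem_cons, List.mem_flatMap, List.mem_map]
    exact .inr ⟨_, ⟨x, hm x, rfl⟩, _, ⟨y, hm y, rfl⟩, rfl⟩
  have hlo : ∀ K' ∈ T, lo < K' := by
    intro K' hK'
    simp only [hT, thresholds, List.mem_cons, List.mem_flatMap, List.mem_map] at hK'
    rcases hK' with rfl | ⟨_, ⟨x, -, rfl⟩, _, ⟨y, -, rfl⟩, rfl⟩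
    · omega
    · have := (thresh_spec u t b idx hα hcmp hk lo B x y).1
      omega
  -- The largest listed level up to `K` is taken; `lo + 1` ensures that there is one. By maximality
  -- no comparison changes between `K'` and `K`.
  obtain ⟨K', hK', hmax⟩ := Finset.exists_max_image (T.toFinset.filter (· ≤ K)) id
    ⟨lo + 1, by simp only [Finset.mem_filter, List.mem_toFinset]; exact ⟨by simp [hT, thresholds], h1⟩⟩
  simp only [Finset.mem_filter, List.mem_toFinset, id] at hK' hmax
  have hq : ∀ x y, quality α u t k K' y < quality α u t k K' x ↔
      quality α u t k K y < quality α u t k K x := by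
    intro x y
    refine (thresh_spec u t b idx hα hcmp hk lo B x y).2 K' K (hlo _ hK'.1) (by omega) h1 h2 ?_
    constructor
    · intro h3
      by_contra h4
      have := hmax _ ⟨hmem x y, by omega⟩
      omega
    · intro h3; omega
  refine ⟨K', hK'.1, fun x y => ?_⟩
  -- Ties are preserved because the strict comparisons are preserved in both directions, which uses
  -- the thresholds of both `(x, y)` and `(y, x)`.
  have e : quality α u t k K' x = quality α u t k K' y ↔
      quality α u t k K x = quality α u t k K y := by
    rw [le_antisymm_iff, le_antisymm_iff, ← not_lt, ← not_lt, hq, hq, not_lt, not_lt]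
  simp only [sortKey, Prod.Lex.toLex_le_toLex, neg_lt_neg_iff, neg_inj, hq, e]

theorem bestLevel_le (hl : l.Nodup) (hm : ∀ o, o ∈ l) (lo B : ℤ) (p : Ω → Bool) {K : ℤ}
    (h1 : lo < K) (h2 : K < lo + 2 ^ zlen (B + B)) :
    setCost t (Finset.univ.filter fun o => p o = true) (bestLevel lo (stepList B)
      (l.map (toItem u t b idx)) ((l.filter p).map (toItem u t b idx))) ≤
    setCost t (Finset.univ.filter fun o => p o = true) K := by
  rw [bestLevel, stepList_eq]
  simp only [ballotCost_eq u t b idx hl hm]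
  obtain ⟨h3, h4, h5⟩ := bisect_spec
    (test := fun K => decide (setCost t (Finset.univ.filter fun o => p o = true) K <
      setCost t (Finset.univ.filter fun o => p o = true) (K - 1)))
    (fun K K' hK h => by
      have := setCost_diff_mono t (Finset.univ.filter fun o => p o = true) hK
      simp only [decide_eq_true_eq] at h ⊢
      omega) (zlen (B + B)) lo
  exact le_of_threshold h3 h4 (fun K a1 a2 => by
    have := h5 K a1 a2
    rwa [decide_eq_true_eq] at this) h1.le h2

theorem levelBound_spec (hl : l.Nodup) (hm : ∀ o, o ∈ l) :
    0 < levelBound (l.map (toItem u t b idx)) ∧ ∀ o, -levelBound (l.map (toItem u t b idx)) < t o ∧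
      t o + 1 < levelBound (l.map (toItem u t b idx)) := by
  rw [levelBound, sum_all_eq u t b idx hl hm]
  change 0 < ∑ o, t o * t o + 2 ∧ ∀ o, -(∑ o, t o * t o + 2) < t o ∧
    t o + 1 < ∑ o, t o * t o + 2
  have h0 : 0 ≤ ∑ o, t o * t o := Finset.sum_nonneg fun o _ => mul_self_nonneg _
  refine ⟨by omega, fun o => ?_⟩
  have h1 : t o * t o ≤ ∑ o, t o * t o :=
    Finset.single_le_sum (f := fun o => t o * t o) (fun o _ => mul_self_nonneg _)
      (Finset.mem_univ o)
  constructor <;> nlinarith [Int.le_self_sq (t o), Int.le_self_sq (-t o)]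

/-- Soundness is immediate: an accepted pair is genuine even if the chosen set does not have `k`
elements. For completeness a given pair is replaced by one that the search meets. -/
theorem improves_iff (hα : 0 < α) (hcmp : ∀ X Y : ℤ, cmp X Y = true ↔ α * Y < X) (hl : l.Nodup)
    (hm : ∀ o, o ∈ l) (hidx : Function.Injective idx)
    (hsurj : ∀ k : ℕ, k < Fintype.card Ω → ∃ o, idx o = k) :
    improves cmp (l.map (toItem u t b idx)) = true ↔
      ∃ W : Finset Ω, W.Nonempty ∧ ∃ K, Better α u t (topSet t b) (∑ o, b o * b o) W K := by
  obtain ⟨hB0, hB⟩ := levelBound_spec u t b idx hl hm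
  simp only [improves, List.any_eq_true, List.mem_map]
  set B := levelBound (l.map (toItem u t b idx))
  constructor
  · rintro ⟨_, ⟨z, -, rfl⟩, K, -, _, ⟨w, -, rfl⟩, h⟩
    rw [chosen_eq u t b idx hcmp, accept_iff u t b idx hcmp hl hm] at h
    exact ⟨_, ⟨w, by simp⟩, _, h⟩
  · rintro ⟨V, hV, K₀, h⟩
    obtain ⟨K, hK1, hK2, hK⟩ := exists_clamp t V K₀ hB hB0
    replace h := h.of_cost_le hα hK
    have hcard : 0 < V.card := hV.card_pos
    have hK3 : K < -B + 2 ^ zlen (B + B) := hK2.trans (lt_two_pow_steps B)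
    -- Numbers start at `0`, so the outcome numbered `V.card - 1` makes the search try `V.card`
    -- winners.
    obtain ⟨z, hz⟩ := hsurj (V.card - 1) (by have := V.card_le_univ; omega)
    have hz' : (toItem u t b idx z).idx + 1 = V.card := by
      change idx z + 1 = V.card
      omega
    obtain ⟨w, hw⟩ := exists_pivot (sortKey u t idx α V.card K)
      (fun x y hxy => hidx (congrArg (fun z => (ofLex z).2) hxy)) V.card hcard V.card_le_univ
    obtain ⟨K', hK', hord⟩ := exists_threshold u t b idx hα hcmp (k := V.card) (by positivity) hm
      (-B) B hK1 hK3
    refine ⟨_, ⟨z, hm z, rfl⟩, K', by rwa [hz'], _, ⟨w, hm w, rfl⟩, ?_⟩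
    rw [hz', chosen_eq u t b idx hcmp, accept_iff u t b idx hcmp hl hm]
    -- The best level for the chosen set costs no more than `K`, so the comparison with `V` can be
    -- made at `K`, where the chosen set has the largest qualities.
    refine Better.of_cost_le hα ?_ (bestLevel_le u t b idx hl hm (-B) B _ hK1 hK3)
    simp only [hord, decide_eq_true_eq]
    rw [better_iff] at h ⊢
    rw [hw]
    refine h.trans_le (mul_le_mul_of_nonneg_left ?_ (by positivity))
    refine sum_le_sum_of_threshold _ (quality α u t V.card K w) hw.symm (fun x hx => ?_)
      fun x hx => ?_
    · simp only [Finset.mem_filter, Finset.mem_univ, true_and, sortKey,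
        Prod.Lex.toLex_le_toLex, neg_lt_neg_iff, neg_inj] at hx
      rcases hx with hx | hx
      exacts [hx.le, hx.1.ge]
    · rw [Finset.mem_filter, and_iff_right (Finset.mem_univ _), not_le] at hx
      simp only [sortKey, Prod.Lex.toLex_lt_toLex, neg_lt_neg_iff, neg_inj] at hx
      rcases hx with hx | hx
      exacts [hx.le, hx.1.ge]

end Search

/-! ### Beneficial deviations -/

section Deviation

variable {N Ω : Type} [Fintype N] [Fintype Ω]

theorem sum_mul_electionProb (u : Ω → ℤ) (v : Profile N Ω) :
    ∑ ω, (u ω : ℝ) * electionProb v ω =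
      ((∑ ω ∈ winners v, u ω : ℤ) : ℝ) / (winners v).card := by
  classical
  simp only [electionProb, mul_ite, mul_zero]
  rw [Finset.sum_ite_mem, Finset.univ_inter, ← Finset.sum_mul, mul_one_div]
  push_cast
  rfl

theorem winners_nonempty [Nonempty Ω] (v : Profile N Ω) : (winners v).Nonempty := by
  obtain ⟨ω, -, h⟩ := Finset.exists_max_image Finset.univ (totalVotes v) Finset.univ_nonempty
  exact ⟨ω, by simpa [winners] using fun ω' => h ω' (Finset.mem_univ _)⟩

omit [Fintype Ω] in
theorem totalVotes_update [DecidableEq N] (v : Profile N Ω) (i : N) (σ : Ω → ℤ) (ω : Ω) :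
    totalVotes (Function.update v i σ) ω = totalVotes v ω - v i ω + σ ω := by
  unfold totalVotes
  rw [← Finset.add_sum_erase _ _ (Finset.mem_univ i), ← Finset.add_sum_erase _ _ (Finset.mem_univ i),
    Function.update_self, Finset.sum_congr rfl fun j hj => by
      rw [Function.update_of_ne (Finset.ne_of_mem_erase hj)]]
  ring

-- The refund depends only on the other ballots and cancels, whatever the number of agents.
open Classical in
theorem utility_lt_update_iff (α : ℝ) (u : N → Ω → ℤ) (v : Profile N Ω) (i : N) (σ : Ω → ℤ) :
    utility α u v i < utility α u (Function.update v i σ) i ↔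
      ((∑ ω ∈ winners v, u i ω : ℤ) : ℝ) / (winners v).card - α * (∑ ω, v i ω * v i ω : ℤ) <
        ((∑ ω ∈ winners (Function.update v i σ), u i ω : ℤ) : ℝ) /
          (winners (Function.update v i σ)).card - α * (∑ ω, σ ω * σ ω : ℤ) := by
  have hp : ∀ b : Ω → ℤ, price α b = α * (∑ ω, b ω * b ω : ℤ) := by
    intro b
    rw [price]
    push_cast
    simp only [sq]
  have hr : ∑ j ∈ Finset.univ.erase i, price α (Function.update v i σ j) =
      ∑ j ∈ Finset.univ.erase i, price α (v j) :=
    Finset.sum_congr rfl fun j hj => by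
      rw [Function.update_of_ne (Finset.ne_of_mem_erase hj)]
  unfold utility
  rw [sum_mul_electionProb, sum_mul_electionProb, Function.update_self, hp, hp,
    hr, add_lt_add_iff_right]

theorem div_sub_lt_div_sub_iff {a s s₀ k k₀ C C₀ : ℝ} (hk : 0 < k) (hk₀ : 0 < k₀) :
    s₀ / k₀ - a * C₀ < s / k - a * C ↔ a * (k * k₀ * (C - C₀)) < s * k₀ - s₀ * k := by
  rw [← sub_pos, ← sub_pos (b := a * _)]
  rw [show s * k₀ - s₀ * k - a * (k * k₀ * (C - C₀)) =
    (s / k - a * C - (s₀ / k₀ - a * C₀)) * (k * k₀) by field_simp; ring]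
  exact (mul_pos_iff_of_pos_right (mul_pos hk hk₀)).symm

theorem topSet_eq_winners (v : Profile N Ω) (t b : Ω → ℤ) (h : ∀ ω, t ω + b ω = totalVotes v ω) :
    topSet t b = winners v := by
  ext ω
  simp [topSet, winners, h]

variable [DecidableEq Ω]

/-- A ballot costs at least `setCost` of its winners at their level, and every nonempty `W` and
every `K` are realised by a ballot of exactly this cost. -/
theorem hasBeneficialDeviation_iff (α : ℝ) (hα : 0 < α) (u : N → Ω → ℤ) (v : Profile N Ω) (i : N) :
    HasBeneficialDeviation α u v i ↔
      ∃ W : Finset Ω, W.Nonempty ∧ ∃ K, Better α (u i) (fun o => totalVotes v o - v i o)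
        (topSet (fun o => totalVotes v o - v i o) (v i)) (∑ o, v i o * v i o) W K := by
  classical
  rw [topSet_eq_winners v _ _ fun ω => sub_add_cancel _ _]
  set t := fun o => totalVotes v o - v i o with ht
  have htot : ∀ (σ : Ω → ℤ) ω, totalVotes (Function.update v i σ) ω = t ω + σ ω :=
    totalVotes_update v i
  rcases isEmpty_or_nonempty Ω with hΩ | hΩ
  -- Without outcomes there is only one ballot and no nonempty set of winners.
  · constructor
    · rintro ⟨σ, h⟩
      obtain rfl : σ = v i := Subsingleton.elim _ _
      simp at h
    · rintro ⟨W, ⟨ω, -⟩, -⟩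
      exact hΩ.elim ω
  have hpos : ∀ v : Profile N Ω, (0 : ℝ) < (winners v).card := fun v =>
    Nat.cast_pos.2 (winners_nonempty v).card_pos
  have hb : ∀ σ, utility α u v i < utility α u (Function.update v i σ) i ↔
      α * (((winners (Function.update v i σ)).card * (winners v).card *
        (∑ ω, σ ω * σ ω - ∑ ω, v i ω * v i ω) : ℤ) : ℝ) <
      (((∑ ω ∈ winners (Function.update v i σ), u i ω) * (winners v).card -
        (∑ ω ∈ winners v, u i ω) * (winners (Function.update v i σ)).card : ℤ) : ℝ) := by
    intro σ
    rw [utility_lt_update_iff, div_sub_lt_div_sub_iff (hpos _) (hpos _)]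
    push_cast
    rfl
  constructor
  · rintro ⟨σ, h⟩
    rw [hb] at h
    obtain ⟨x, hx⟩ := winners_nonempty (Function.update v i σ)
    refine ⟨_, ⟨x, hx⟩, t x + σ x, lt_of_le_of_lt (mul_le_mul_of_nonneg_left ?_ hα.le) h⟩
    have hc : setCost t (winners (Function.update v i σ)) (t x + σ x) ≤ ∑ ω, σ ω * σ ω := by
      rw [setCost_eq]
      refine Finset.sum_le_sum fun ω _ => ?_
      have hx : ∀ y, t y + σ y ≤ t x + σ x := by simpa [winners, htot] using hx
      split_ifs with hω
      · have hω : ∀ y, t y + σ y ≤ t ω + σ ω := by simpa [winners, htot] using hω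
        rw [show t x + σ x - t ω = σ ω by linarith [hx ω, hω x]]
      · refine loseCost_le ?_
        by_contra hlt
        refine hω ?_
        simp only [winners, htot, Finset.mem_filter, Finset.mem_univ, true_and]
        intro y
        linarith [hx y]
    exact_mod_cast mul_le_mul_of_nonneg_left (sub_le_sub_right hc _) (by positivity)
  · rintro ⟨W, ⟨x, hx⟩, K, h⟩
    -- Winners are brought exactly to `K`; a loser gets no votes if it is already below `K`, and
    -- otherwise just enough negative votes to reach `K - 1`.
    set σ : Ω → ℤ := fun ω => if ω ∈ W then K - t ω else min 0 (K - t ω - 1) with hσ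
    have h1 : ∀ ω ∈ W, t ω + σ ω = K := fun ω hω => by simp [hσ, hω]
    have h2 : ∀ ω ∉ W, t ω + σ ω < K := fun ω hω => by
      simp only [hσ, hω, if_false]
      omega
    have hW : winners (Function.update v i σ) = W := by
      ext ω
      simp only [winners, htot, Finset.mem_filter, Finset.mem_univ, true_and]
      constructor
      · intro hω
        by_contra hωW
        linarith [hω x, h1 x hx, h2 ω hωW]
      · intro hω y
        rw [h1 ω hω]
        by_cases hy : y ∈ W
        · exact (h1 y hy).le
        · exact (h2 y hy).le
    have hC : ∑ ω, σ ω * σ ω = setCost t W K := by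
      rw [setCost_eq]
      refine Finset.sum_congr rfl fun ω _ => ?_
      by_cases hω : ω ∈ W
      · simp [hσ, hω]
      · simp only [hσ, hω, if_false, loseCost_eq]
    refine ⟨σ, ?_⟩
    rw [hb, hW, hC]
    exact h

end Deviation

/-! ### The two constants -/

/-- The comparison with `α`, given a decision procedure for natural numbers. -/
def signedCmp (f : List Sym → Bool) (X Y : ℤ) : Bool :=
  if 0 ≤ Y then decide (0 ≤ X) && f (intCode X ++ Sym.comma :: intCode Y)
  else !(decide (0 ≤ -X) && f (intCode (-X) ++ Sym.comma :: intCode (-Y)))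

theorem PT.signedCmp {tm : FinTM2} {f : List Sym → Bool} (hf : PT tm f) :
    PT tm fun x : ℤ × ℤ => signedCmp f x.1 x.2 := by
  unfold QV.signedCmp
  have h (X Y : ℤ × ℤ → ℤ) (hX : PT tm X) (hY : PT tm Y) :
      PT tm fun x => f (QV.intCode (X x) ++ Sym.comma :: QV.intCode (Y x)) := hf.comp (by fun_prop)
  have h1 := h (fun x => x.1) (fun x => x.2) (by fun_prop) (by fun_prop)
  have h2 := h (fun x => -x.1) (fun x => -x.2) (by fun_prop) (by fun_prop)
  fun_prop

theorem mem_comparison_iff (α : ℝ) (p q : ℕ) :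
    natCode p ++ Sym.comma :: natCode q ∈ Comparison α ↔ α * q < p := by
  constructor
  · rintro ⟨p', q', h, hlt⟩
    have hc : ∀ n, Sym.comma ∉ natCode n := fun n h => by
      rw [natCode_eq_intCode] at h
      exact (mem_intCode h).1 rfl
    obtain ⟨h1, h2⟩ := append_cons_inj (hc _) (hc _) h
    rwa [← natCode_injective h1, ← natCode_injective h2]
  · exact fun h => ⟨p, q, rfl, h⟩

/-- For negative `Y` the negated query gives only `α * Y ≤ X`; irrationality excludes equality since
`Y ≠ 0`. -/
theorem signedCmp_iff {α : ℝ} (hα : 0 < α) (hirr : Irrational α) {f : List Sym → Bool}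
    (hf : ∀ w, f w = true ↔ w ∈ Comparison α) (X Y : ℤ) :
    signedCmp f X Y = true ↔ α * Y < X := by
  have key : ∀ X Y : ℤ, 0 ≤ Y →
      ((decide (0 ≤ X) && f (intCode X ++ Sym.comma :: intCode Y)) = true ↔ α * Y < X) := by
    intro X Y hY
    lift Y to ℕ using hY
    rcases lt_or_ge X 0 with hX | hX
    · have h1 : (X : ℝ) < 0 := by exact_mod_cast hX
      have h2 : 0 ≤ α * ((Y : ℤ) : ℝ) := by positivity
      simp only [decide_eq_false (not_le.2 hX), Bool.false_and, Bool.false_eq_true, false_iff,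
        not_lt]
      linarith
    · lift X to ℕ using hX
      rw [← natCode_eq_intCode, ← natCode_eq_intCode, Bool.and_eq_true, hf, mem_comparison_iff]
      simp
  rw [signedCmp]
  split_ifs with hY
  · exact key X Y hY
  · rw [Bool.not_eq_true', ← Bool.not_eq_true, key _ _ (by omega)]
    have hne : α * Y ≠ X := fun h => (hirr.mul_intCast (by omega : Y ≠ 0)).ne_int X h
    push_cast
    constructor
    · intro h
      exact lt_of_le_of_ne (by linarith) hne
    · intro h; linarith

/-! ### The theorem -/

theorem inP_DEVIATE {α : ℝ} (hα : 0 < α) {tm : FinTM2} {cmp : ℤ → ℤ → Bool}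
    (hPT : PT tm fun x : ℤ × ℤ => cmp x.1 x.2)
    (hcmp : ∀ X Y : ℤ, cmp X Y = true ↔ α * Y < X) : InP (DEVIATE α) := by
  refine (PT.decideWord hPT).inP fun w => ?_
  rw [decideWord_eq_true]
  refine exists_congr fun I => and_congr_right fun _ => ?_
  rw [hasBeneficialDeviation_iff α hα]
  exact improves_iff (I.u I.i) (fun o => totalVotes I.v o - I.v I.i o) (I.v I.i)
    (fun o => ((o : ℕ) : ℤ)) hα hcmp (List.nodup_reverse.2 (List.nodup_finRange _))
    (fun o => by simp) (fun a b h => Fin.ext (Int.ofNat_inj.1 h))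
    fun k hk => ⟨⟨k, by simpa using hk⟩, rfl⟩

theorem inP_DEVIATE_ratCast (α : ℚ) (hα : 0 < α) : InP (DEVIATE (α : ℝ)) := by
  -- Cross-multiplication makes the test pure integer arithmetic, so any machine can serve as the
  -- unused subroutine.
  refine inP_DEVIATE (tm := default) (cmp := fun X Y => decide (α.num * Y < α.den * X))
    (by exact_mod_cast hα) (by fun_prop) fun X Y => ?_
  have hd : (0 : ℝ) < α.den := by exact_mod_cast α.den_pos
  have h : (α : ℝ) * α.den = α.num := by exact_mod_cast Rat.mul_den_eq_num α
  rw [decide_eq_true_eq, ← mul_lt_mul_iff_right₀ hd, ← @Int.cast_lt ℝ]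
  push_cast
  rw [← h, mul_comm (α : ℝ) _, mul_assoc]

end QV

theorem mainTheorem1 :
    (∀ α : ℚ, 0 < α → QV.InP (QV.DEVIATE (α : ℝ))) ∧
    (∀ α : ℝ, 0 < α → QV.InP (QV.Comparison α) → QV.InP (QV.DEVIATE α)) := by
  refine ⟨QV.inP_DEVIATE_ratCast, fun α hα h => ?_⟩
  -- A rational constant needs no comparison procedure, so the procedure is used only where
  -- `signedCmp` is correct.
  by_cases hirr : Irrational α
  · obtain ⟨tm, f, hf, hPT⟩ := h.exists_PT
    exact QV.inP_DEVIATE hα hPT.signedCmp (QV.signedCmp_iff hα hirr hf)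
  · obtain ⟨q, rfl⟩ : ∃ q : ℚ, (q : ℝ) = α := by simpa [Irrational] using hirr
    exact QV.inP_DEVIATE_ratCast q (by exact_mod_cast hα)
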